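/- **Setting.** Let $N\ge 1$, $\rho>0$, $0<t<\frac1{2\rho}$. Let $X\subseteq\mathbb R^n$ be nonempty, closed and convex, and let $f_1,\dots,f_N:\mathbb R^n\to\mathbb R$ be $\rho$-weakly convex (i.e. $f_i+\frac\rho2\|\cdot\|^2$ is convex) and $L$-Lipschitz on $X$, with $\|g\|\le L$ for all $g\in\partial f_i(x)$, $x\in X$ (automatic if $f_i$ is $L$-Lipschitz near $X$), where $\partial f_i(x)=\{g: f_i(y)\ge f_i(x)+\langle g,y-x\rangle+o(\|y-x\|)\text{ as }y\to x\}$. Assume that $f=\frac1N\sum_i f_i$ is bounded below on $X$. Let $A(k)=(a_{ij}(k))$, $k\ge0$, be doubly stochastic $N\times N$ matrices such that, for some $\eta>0$ and some integer $B\ge1$: $a_{ii}(k)\ge\eta$; each $a_{ij}(k)$ is $0$ or at least $\eta$; and for every $k\ge 0$ the directed graph with edges $(j,i)$ such that $a_{ij}(l)>0$ for some $kB\le l<(k+1)B$ is strongly connected. The distributed projected subgradient method with stepsizes $\alpha_k>0$ starts from $x_{i,0}\in X$ and takes $$v_{i,k}=\sum_j a_{ij}(k)x_{j,k},\qquad x_{i,k+1}=\mathrm{Proj}_X(v_{i,k}-\alpha_k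 g_{i,k}),\qquad g_{i,k}\in\partial f_i(v_{i,k}).$$ Put $\bar x_k=\frac1N\sum_i x_{i,k}$, $\varphi_t(x)=\min_{y\in X}\{f(y)+\frac1{2t}\|y-x\|^2\}$ and $\bar\varphi_{t,k}=\frac1N\sum_i\varphi_t(x_{i,k})$. A pair $c>0$, $\lambda\in(0,1)$ is called a mixing pair if $\|A(k)A(k-1)\cdots A(s)-\frac1N\mathbf 1\mathbf 1^\top\|\le c\lambda^{k-s}$ for all $k\ge s\ge0$, in the operator norm. **Claim.** The function $\varphi_t$ is differentiable on $\mathbb R^n$, and every network as above has a mixing pair. Moreover, if $\alpha_{k+1}/\alpha_k\to1$, then: 1. If $\sum_k\alpha_k=\infty$ and $\sum_k\alpha_k^2<\infty$, then $\bar\varphi_{t,k}$ converges to some real $\bar\varphi_t$, and $\varphi_t(\bar x_k)\to\bar\varphi_t$. 2. Let $(c,\lambda)$ be a mixing pair, let $c_1,c_2>0$, and suppose that $\alpha_k\le c_2/\sqrt k$ for all large $k$. Let $\bar\varphi_t$ be any real number with $\bar\varphi_t\le\liminf_k\bar\varphi_{t,k}$ (for example the limit in part 1, if it exists). There is a constant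 $C>0$, depending only on $N,\rho,t,c,c_1,c_2$, such that, with $S_T=\sum_{k=1}^T\alpha_k$, for all sufficiently large $T$ $$\min_{1\le k\le T}\|\nabla\varphi_t(\bar x_k)\|^2\le C\left(\frac{\bar\varphi_{t,0}-\bar\varphi_t}{S_T}+\frac{L^2}{(1-\lambda)^2}\cdot\frac{\log T}{S_T}\right);$$ and if moreover $\alpha_k\ge c_1/\sqrt k$ for all large $k$, i.e. $\alpha_k$ is of order $1/\sqrt k$, then for all sufficiently large $T$ $$\min_{1\le k\le T}\|\nabla\varphi_t(\bar x_k)\|^2\le C\left(\frac{\bar\varphi_{t,0}-\bar\varphi_t}{\sqrt T}+\frac{L^2}{(1-\lambda)^2}\cdot\frac{\log T}{\sqrt T}\right).$$ -/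

import Mathlib

open Filter Topology

noncomputable section

namespace DPSM

/-- `ℝⁿ` with the Euclidean norm. -/
abbrev E (n : ℕ) := EuclideanSpace ℝ (Fin n)

/-- `f` is `ρ`-weakly convex: `f + (ρ/2)‖·‖²` is convex on `ℝⁿ`. -/
def IsWeaklyConvex {n : ℕ} (ρ : ℝ) (f : E n → ℝ) : Prop :=
  ConvexOn ℝ Set.univ fun x => f x + ρ / 2 * ‖x‖ ^ 2

/-- The (Fréchet, or regular) subdifferential: all `g` with
`f y ≥ f x + ⟪g, y - x⟫ + o(‖y - x‖)` as `y → x`. -/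
def subdiff {n : ℕ} (f : E n → ℝ) (x : E n) : Set (E n) :=
  {g | ∀ ε > 0, ∀ᶠ y in 𝓝 x, f x + inner ℝ g (y - x) - ε * ‖y - x‖ ≤ f y}

/-- `p` is a Euclidean projection of `z` onto `X` (unique if `X` is closed and convex). -/
def IsProj {n : ℕ} (X : Set (E n)) (z p : E n) : Prop :=
  p ∈ X ∧ ∀ y ∈ X, ‖z - p‖ ≤ ‖z - y‖

/-- The global objective `f = (1/N) ∑ᵢ fᵢ`. -/
def objective {n N : ℕ} (f : Fin N → E n → ℝ) (x : E n) : ℝ :=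
  (1 / (N : ℝ)) * ∑ i, f i x

/-- The Moreau envelope `φ_t(x) = min_{y ∈ X} F(y) + ‖y - x‖² / (2t)` of `F` over `X`. -/
def moreau {n : ℕ} (X : Set (E n)) (F : E n → ℝ) (t : ℝ) (x : E n) : ℝ :=
  ⨅ y : X, (F y + ‖(y : E n) - x‖ ^ 2 / (2 * t))

/-- The constrained problem: minimise `(1/N) ∑ᵢ fᵢ` over a closed convex set `X`, where the `fᵢ` are
`ρ`-weakly convex and `L`-Lipschitz on `X` with subgradients bounded by `L` on `X`, and the
objective is bounded below on `X`. -/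
structure IsProblem {n N : ℕ} (X : Set (E n)) (f : Fin N → E n → ℝ) (ρ : ℝ) (L : NNReal) :
    Prop where
  nonempty : X.Nonempty
  isClosed : IsClosed X
  convex : Convex ℝ X
  weaklyConvex : ∀ i, IsWeaklyConvex ρ (f i)
  lipschitz : ∀ i, LipschitzOnWith L (f i) X
  subgradient_le : ∀ i, ∀ x ∈ X, ∀ g ∈ subdiff (f i) x, ‖g‖ ≤ L
  bddBelow : BddBelow (objective f '' X)

/-- Time-varying network: `A k i j` is the weight that agent `i` gives to agent `j` at time `k`, and
`(j, i)` is an edge of the graph at time `k` iff this weight is positive. The weight matrices are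
doubly stochastic, the self-weights and the positive weights are at least `η`, and the network is
`B`-connected: over each block of times `kB, …, (k+1)B - 1` the union of the graphs is strongly
connected. -/
structure IsNetwork {N : ℕ} (A : ℕ → Matrix (Fin N) (Fin N) ℝ) (η : ℝ) (B : ℕ) : Prop where
  eta_pos : 0 < η
  B_pos : 0 < B
  doublyStochastic : ∀ k, A k ∈ doublyStochastic ℝ (Fin N)
  self_weight : ∀ k i, η ≤ A k i i
  weight : ∀ k i j, A k i j = 0 ∨ η ≤ A k i j
  connected : ∀ k i j, Relation.ReflTransGen
    (fun p q => ∃ l, k * B ≤ l ∧ l < (k + 1) * B ∧ 0 < A l q p) i j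

/-- `transition A s m = Φ(s + m, s) = A(s+m) ⋯ A(s+1) A(s)`. -/
def transition {N : ℕ} (A : ℕ → Matrix (Fin N) (Fin N) ℝ) (s : ℕ) : ℕ → Matrix (Fin N) (Fin N) ℝ
  | 0 => A s
  | m + 1 => A (s + m + 1) * transition A s m

/-- The network mixes geometrically with rate `lam` and factor `c`: for all `k ≥ s`,
`‖Φ(k, s) - (1/N) 1 1ᵀ‖ ≤ c lam ^ (k - s)` in the spectral (operator) norm. -/
def IsMixing {N : ℕ} (A : ℕ → Matrix (Fin N) (Fin N) ℝ) (c lam : ℝ) : Prop :=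
  ∀ s m : ℕ, ‖Matrix.toEuclideanCLM (n := Fin N) (𝕜 := ℝ)
    (transition A s m - Matrix.of fun _ _ => 1 / (N : ℝ))‖ ≤ c * lam ^ m

/-- The averaged (consensus) point `v_{i,k} = ∑ⱼ a_{ij}(k) x_{j,k}`. -/
def mix {n N : ℕ} (A : ℕ → Matrix (Fin N) (Fin N) ℝ) (x : ℕ → Fin N → E n) (k : ℕ) (i : Fin N) :
    E n :=
  ∑ j, A k i j • x k j

/-- `x k i = x_{i,k}` are iterates of the distributed projected subgradient method:
`x_{i,0} ∈ X` and `x_{i,k+1} = Proj_X (v_{i,k} - α_k g_{i,k})` for some `g_{i,k} ∈ ∂fᵢ(v_{i,k})`. -/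
structure IsRun {n N : ℕ} (X : Set (E n)) (f : Fin N → E n → ℝ)
    (A : ℕ → Matrix (Fin N) (Fin N) ℝ) (α : ℕ → ℝ) (x : ℕ → Fin N → E n) : Prop where
  init : ∀ i, x 0 i ∈ X
  step : ∀ k i, ∃ g ∈ subdiff (f i) (mix A x k i),
    IsProj X (mix A x k i - α k • g) (x (k + 1) i)

/-- The network average `x̄_k`. -/
def xbar {n N : ℕ} (x : ℕ → Fin N → E n) (k : ℕ) : E n :=
  (1 / (N : ℝ)) • ∑ i, x k i

/-- The averaged envelope value `φ̄_{t,k} = (1/N) ∑ᵢ φ_t(x_{i,k})`. -/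
def phibar {n N : ℕ} (X : Set (E n)) (f : Fin N → E n → ℝ) (t : ℝ) (x : ℕ → Fin N → E n) (k : ℕ) :
    ℝ :=
  (1 / (N : ℝ)) * ∑ i, moreau X (objective f) t (x k i)

end DPSM

end

/-!
The Moreau envelope `φ` of the objective `F` over `X` serves as a Lyapunov function. As `2ρt < 1`, the
proximal objective is strongly convex on `X`, so it grows quadratically away from its minimiser
(`IsRegular.prox_growth`). Hence `prox` is Lipschitz, `φ` lies between two quadratics touching it at
any given point `x` with slope `(x - prox x) / t`, and `φ` is differentiable with this gradient
(`IsRegular.hasGradientAt_moreau`).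

One step of the method is compared with the proximal point of the network average `z = x̄_k`. The
subgradient inequality for `fᵢ`, the projection property and the decrease of `F` at the proximal point
lower the average of `φ` by `(α_k / 2) ‖∇φ(z)‖²`. The errors are quadratic in the stepsize and in the
disagreement `D` of the agents: the first-order terms of `φ` cancel, because the deviations from the
average sum to zero, and the cross terms `α_k L D` are split by Young's inequality
(`IsRun.phibar_succ_le`).

The disagreement is controlled by the geometric mixing of the transition matrices
(`IsRun.norm_sub_xbar_le`): it is bounded by a convolution of the stepsizes with the powers of `lam`,
whose sum of squares is at most that of the stepsizes divided by `(1 - lam)²`, up to a constant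
(`sum_geomConv_sq_le`). If the squares of the stepsizes are summable, then so are the errors, and the
envelope values converge. If `α_k = O(1/√k)`, then the errors accumulate to `O(log T)`. For `L > 0` the
logarithm eventually dominates every constant of the run, which is why the constant of the rates can be
uniform; for `L = 0` the functions are constant on `X` and all gradients vanish.

Mixing itself (`IsNetwork.exists_isMixing`) comes from connectivity: over each block of `B` times the
set of agents reached from a given one grows until it is everything, so all entries of a product over
`(N + 1) B` times are at least `η ^ ((N + 1) B)`, and such a product contracts the oscillation of every
vector by a fixed factor.
-/

namespace DPSM

/-! ### Weakly convex functions and the Moreau envelope -/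

section Moreau

variable {n : ℕ} {X : Set (E n)} {F : E n → ℝ} {ρ t : ℝ} {L : NNReal}

/-- The inequality of weak convexity on a segment, in incremental form. -/
theorem IsWeaklyConvex.le_segment (hF : IsWeaklyConvex ρ F) (a b : E n) {s : ℝ}
    (hs₀ : 0 ≤ s) (hs₁ : s ≤ 1) :
    F (a + s • (b - a)) ≤ F a + s * (F b - F a) + ρ / 2 * (s * (1 - s)) * ‖b - a‖ ^ 2 := by
  have h := hF.2 (Set.mem_univ a) (Set.mem_univ b) (sub_nonneg.2 hs₁) hs₀ (by ring)
  have e : (1 - s) • a + s • b = a + s • (b - a) := by module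
  simp only [e, smul_eq_mul] at h
  have h₁ : ‖a + s • (b - a)‖ ^ 2
      = ‖a‖ ^ 2 + 2 * s * inner ℝ a (b - a) + s ^ 2 * ‖b - a‖ ^ 2 := by
    rw [norm_add_sq_real, real_inner_smul_right, norm_smul, mul_pow, Real.norm_eq_abs, sq_abs]
    ring
  have h₂ : ‖b‖ ^ 2 = ‖a‖ ^ 2 + 2 * inner ℝ a (b - a) + ‖b - a‖ ^ 2 := by
    rw [← norm_add_sq_real]; congr 2; abel
  rw [h₁, h₂] at h
  linarith

/-- Lets the parameter `s` of a segment tend to `0` in an inequality with an error of order `s`. -/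
theorem le_of_forall_small_mul {a b K : ℝ} (h : ∀ s, 0 < s → s ≤ 1 → a ≤ b + s * K) : a ≤ b := by
  have ht : Tendsto (fun s : ℝ => b + s * K) (𝓝[>] 0) (𝓝 (b + 0 * K)) :=
    ((continuous_const.add (continuous_id.mul continuous_const)).tendsto 0).mono_left
      nhdsWithin_le_nhds
  rw [zero_mul, add_zero] at ht
  refine ge_of_tendsto ht ?_
  filter_upwards [Ioc_mem_nhdsGT (zero_lt_one (α := ℝ))] with s hs using h s hs.1 hs.2

/-- A Fréchet subgradient of a weakly convex function gives a global quadratic minorant. -/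
theorem IsWeaklyConvex.subgradient_inequality (hF : IsWeaklyConvex ρ F) {v g : E n}
    (hg : g ∈ subdiff F v) (p : E n) :
    inner ℝ g (p - v) ≤ F p - F v + ρ / 2 * ‖p - v‖ ^ 2 := by
  have key : ∀ ε > 0, inner ℝ g (p - v) - ε * ‖p - v‖ ≤ F p - F v + ρ / 2 * ‖p - v‖ ^ 2 := by
    intro ε hε
    have hc : Tendsto (fun s : ℝ => v + s • (p - v)) (𝓝[>] 0) (𝓝 v) := by
      have : Continuous fun s : ℝ => v + s • (p - v) := by fun_prop
      simpa using (this.tendsto 0).mono_left nhdsWithin_le_nhds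
    have hlim : Tendsto (fun s : ℝ => F p - F v + ρ / 2 * (1 - s) * ‖p - v‖ ^ 2) (𝓝[>] 0)
        (𝓝 (F p - F v + ρ / 2 * ‖p - v‖ ^ 2)) := by
      have : Continuous fun s : ℝ => F p - F v + ρ / 2 * (1 - s) * ‖p - v‖ ^ 2 := by fun_prop
      simpa using (this.tendsto 0).mono_left nhdsWithin_le_nhds
    refine ge_of_tendsto hlim ?_
    filter_upwards [hc.eventually (hg ε hε), Ioc_mem_nhdsGT (zero_lt_one (α := ℝ))] with s hs hs'
    have h := hF.le_segment v p hs'.1.le hs'.2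
    simp only [add_sub_cancel_left, real_inner_smul_right, norm_smul, Real.norm_eq_abs,
      abs_of_pos hs'.1] at hs
    have h' : s * (inner ℝ g (p - v) - ε * ‖p - v‖)
        ≤ s * (F p - F v + ρ / 2 * (1 - s) * ‖p - v‖ ^ 2) := by linarith
    exact le_of_mul_le_mul_left h' hs'.1
  refine le_of_forall_small_mul (K := ‖p - v‖) fun s hs _ => ?_
  have := key s hs
  linarith

/-- `p` minimises the proximal objective `F + ‖· - z‖² / (2t)` over `X`. -/
def IsProx (X : Set (E n)) (F : E n → ℝ) (t : ℝ) (z p : E n) : Prop :=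
  p ∈ X ∧ ∀ y ∈ X, F p + ‖p - z‖ ^ 2 / (2 * t) ≤ F y + ‖y - z‖ ^ 2 / (2 * t)

/-- A proximal point of `z`, an arbitrary point where there is none. -/
noncomputable def prox (X : Set (E n)) (F : E n → ℝ) (t : ℝ) (z : E n) : E n :=
  Classical.epsilon (IsProx X F t z)

theorem exists_isProx (hX : X.Nonempty) (hcl : IsClosed X) (hc : ContinuousOn F X)
    (hb : BddBelow (F '' X)) (ht : 0 < t) (z : E n) : ∃ p, IsProx X F t z p := by
  obtain ⟨x₀, hx₀⟩ := hX
  obtain ⟨m, hm⟩ := hb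
  have hcont : ContinuousOn (fun y => F y + ‖y - z‖ ^ 2 / (2 * t)) X :=
    hc.add (by fun_prop)
  have hev : ∀ᶠ y in cocompact (E n) ⊓ 𝓟 X,
      F x₀ + ‖x₀ - z‖ ^ 2 / (2 * t) ≤ F y + ‖y - z‖ ^ 2 / (2 * t) := by
    have h1 : Tendsto (fun y : E n => ‖y - z‖) (cocompact (E n)) atTop := by
      simpa [dist_eq_norm] using tendsto_dist_right_cocompact_atTop z
    have h2 : Tendsto (fun y : E n => ‖y - z‖ ^ 2 / (2 * t)) (cocompact (E n)) atTop :=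
      ((tendsto_pow_atTop two_ne_zero).comp h1).atTop_div_const (by positivity)
    rw [eventually_inf_principal]
    filter_upwards [h2.eventually_ge_atTop (F x₀ + ‖x₀ - z‖ ^ 2 / (2 * t) - m)] with y hy hyX
    have : m ≤ F y := hm (Set.mem_image_of_mem F hyX)
    linarith
  obtain ⟨p, hp, hmin⟩ := hcont.exists_isMinOn' hcl hx₀ hev
  exact ⟨p, hp, fun y hy => hmin hy⟩

/-- The hypotheses on `F` and `X` under which the Moreau envelope is studied. -/
structure IsRegular (X : Set (E n)) (F : E n → ℝ) (ρ t : ℝ) (L : NNReal) : Prop where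
  nonempty : X.Nonempty
  isClosed : IsClosed X
  convex : Convex ℝ X
  weaklyConvex : IsWeaklyConvex ρ F
  lipschitz : LipschitzOnWith L F X
  bddBelow : BddBelow (F '' X)
  t_pos : 0 < t
  rho_mul_t : 2 * ρ * t < 1
  rho_pos : 0 < ρ

namespace IsRegular

variable (h : IsRegular X F ρ t L)

include h

theorem isProx_prox (z : E n) : IsProx X F t z (prox X F t z) :=
  Classical.epsilon_spec
    (exists_isProx h.nonempty h.isClosed h.lipschitz.continuousOn h.bddBelow h.t_pos z)

theorem prox_mem (z : E n) : prox X F t z ∈ X := (h.isProx_prox z).1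

theorem moreau_eq (z : E n) :
    moreau X F t z = F (prox X F t z) + ‖prox X F t z - z‖ ^ 2 / (2 * t) := by
  have hp := h.isProx_prox z
  have : Nonempty X := h.nonempty.to_subtype
  refine le_antisymm ?_ (le_ciInf fun y => hp.2 y y.2)
  exact ciInf_le (f := fun y : X => F y + ‖(y : E n) - z‖ ^ 2 / (2 * t))
    ⟨_, by rintro _ ⟨y, rfl⟩; exact hp.2 y y.2⟩ ⟨_, hp.1⟩

theorem moreau_le (z : E n) {y : E n} (hy : y ∈ X) :
    moreau X F t z ≤ F y + ‖y - z‖ ^ 2 / (2 * t) :=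
  h.moreau_eq z ▸ (h.isProx_prox z).2 y hy

/-- The proximal objective is `(1/t - ρ)`-strongly convex, hence grows quadratically away from its
minimiser. -/
theorem prox_growth (z : E n) {y : E n} (hy : y ∈ X) :
    F (prox X F t z) + ‖prox X F t z - z‖ ^ 2 / (2 * t)
      + (1 / t - ρ) / 2 * ‖y - prox X F t z‖ ^ 2 ≤ F y + ‖y - z‖ ^ 2 / (2 * t) := by
  have hp := h.isProx_prox z
  set p := prox X F t z
  have ht := h.t_pos
  refine le_of_forall_small_mul (K := (1 / t - ρ) / 2 * ‖y - p‖ ^ 2) fun s hs hs₁ => ?_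
  have hm : p + s • (y - p) ∈ X := h.convex.add_smul_sub_mem hp.1 hy ⟨hs.le, hs₁⟩
  have h₁ := hp.2 _ hm
  have h₂ := h.weaklyConvex.le_segment p y hs.le hs₁
  have e₁ : ‖p + s • (y - p) - z‖ ^ 2
      = ‖p - z‖ ^ 2 + 2 * s * inner ℝ (p - z) (y - p) + s ^ 2 * ‖y - p‖ ^ 2 := by
    rw [add_sub_right_comm, norm_add_sq_real, real_inner_smul_right, norm_smul, mul_pow,
      Real.norm_eq_abs, sq_abs]
    ring
  have e₂ : ‖y - z‖ ^ 2 = ‖p - z‖ ^ 2 + 2 * inner ℝ (p - z) (y - p) + ‖y - p‖ ^ 2 := by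
    rw [← norm_add_sq_real]; congr 2; abel
  rw [e₁] at h₁
  rw [e₂]
  refine le_of_mul_le_mul_left ?_ hs
  simp only [div_eq_mul_inv, mul_inv, one_mul] at h₁ h₂ ⊢
  linarith

theorem inv_t_bound : 2 * ρ < 1 / t := by
  rw [lt_div_iff₀ h.t_pos]; exact h.rho_mul_t

theorem norm_prox_sub_le (w z : E n) : ‖prox X F t w - prox X F t z‖ ≤ 2 * ‖w - z‖ := by
  have h₁ := h.prox_growth z (h.prox_mem w)
  have h₂ := h.prox_growth w (h.prox_mem z)
  set p := prox X F t z
  set q := prox X F t w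
  have ht := h.t_pos
  have hin : inner ℝ (q - p) (w - z) ≤ ‖q - p‖ * ‖w - z‖ := real_inner_le_norm _ _
  have e : ‖q - z‖ ^ 2 - ‖p - z‖ ^ 2 + ‖p - w‖ ^ 2 - ‖q - w‖ ^ 2 = 2 * inner ℝ (q - p) (w - z) := by
    simp only [← real_inner_self_eq_norm_sq, inner_sub_left, inner_sub_right,
      real_inner_comm p, real_inner_comm q]
    ring
  rw [norm_sub_rev p q] at h₂
  have h₃ : (1 / t - ρ) * ‖q - p‖ ^ 2 ≤ 1 / t * (‖q - p‖ * ‖w - z‖) := by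
    have e' : ‖q - z‖ ^ 2 / (2 * t) - ‖p - z‖ ^ 2 / (2 * t) + ‖p - w‖ ^ 2 / (2 * t)
        - ‖q - w‖ ^ 2 / (2 * t) = 1 / t * inner ℝ (q - p) (w - z) := by
      rw [← sub_div, ← add_div, ← sub_div, e]; field_simp
    have := mul_le_mul_of_nonneg_left hin (one_div_pos.2 ht).le
    linarith
  have h₄ : 1 / t / 2 * ‖q - p‖ ^ 2 ≤ (1 / t - ρ) * ‖q - p‖ ^ 2 :=
    mul_le_mul_of_nonneg_right (by linarith [h.inv_t_bound]) (sq_nonneg _)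
  have h₅ : ‖q - p‖ * ‖q - p‖ ≤ ‖q - p‖ * (2 * ‖w - z‖) := by
    have : 1 / t * (‖q - p‖ * ‖q - p‖) ≤ 1 / t * (‖q - p‖ * (2 * ‖w - z‖)) := by linarith
    exact le_of_mul_le_mul_left this (one_div_pos.2 ht)
  rcases (norm_nonneg (q - p)).eq_or_lt with h0 | h0
  · rw [← h0]; positivity
  · exact le_of_mul_le_mul_left h₅ h0

theorem abs_sub_le {x y : E n} (hx : x ∈ X) (hy : y ∈ X) : |F x - F y| ≤ L * ‖x - y‖ := by
  simpa [Real.dist_eq, dist_eq_norm] using h.lipschitz.dist_le_mul x hx y hy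

/-- Decrease of `F` at the proximal point, with the room for the error of a subgradient inequality
of a `ρ`-weakly convex function. -/
theorem prox_descent {z : E n} (hz : z ∈ X) :
    F (prox X F t z) - F z + ρ / 2 * ‖prox X F t z - z‖ ^ 2
      ≤ -(1 / (2 * t)) * ‖prox X F t z - z‖ ^ 2 := by
  have h₁ := h.prox_growth z hz
  rw [sub_self, norm_zero, norm_sub_rev z] at h₁
  have h₂ := h.inv_t_bound
  have ht := h.t_pos
  simp only [div_eq_mul_inv, mul_inv, one_mul] at h₁ h₂ ⊢
  nlinarith [sq_nonneg ‖prox X F t z - z‖]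

theorem norm_prox_sub_self_le {z : E n} (hz : z ∈ X) : ‖prox X F t z - z‖ ≤ 2 * t * L := by
  have h₁ := h.prox_descent hz
  have h₂ := (abs_le.1 (h.abs_sub_le (h.prox_mem z) hz)).1
  have ht := h.t_pos
  set d := ‖prox X F t z - z‖ with hd
  have h₃ : 1 / (2 * t) * (d * d) ≤ 1 / (2 * t) * (d * (2 * t * L)) := by
    have : 1 / (2 * t) * (d * (2 * t * L)) = L * d := by field_simp
    have := mul_nonneg h.rho_pos.le (sq_nonneg d)
    nlinarith
  have h₄ := le_of_mul_le_mul_left h₃ (by positivity)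
  rcases (norm_nonneg (prox X F t z - z)).eq_or_lt with h0 | h0
  · rw [hd, ← h0]; positivity
  · exact le_of_mul_le_mul_left h₄ h0

theorem moreau_le_quadratic (x y : E n) :
    moreau X F t y ≤ moreau X F t x + 1 / t * inner ℝ (x - prox X F t x) (y - x)
      + ‖y - x‖ ^ 2 / (2 * t) := by
  have h₁ := h.moreau_le y (h.prox_mem x)
  rw [h.moreau_eq x]
  refine h₁.trans_eq ?_
  have ht := h.t_pos
  set p := prox X F t x
  have e : ‖p - y‖ ^ 2 = ‖p - x‖ ^ 2 + 2 * inner ℝ (x - p) (y - x) + ‖y - x‖ ^ 2 := by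
    rw [norm_sub_rev p y, norm_sub_rev p x, ← norm_add_sq_real]; congr 2; abel
  rw [e]
  field_simp
  ring

theorem norm_residual_sub_le (x y : E n) :
    ‖(x - prox X F t x) - (y - prox X F t y)‖ ≤ 3 * ‖x - y‖ := by
  have e : (x - prox X F t x) - (y - prox X F t y)
      = (x - y) - (prox X F t x - prox X F t y) := by abel
  rw [e]
  linarith [norm_sub_le (x - y) (prox X F t x - prox X F t y), h.norm_prox_sub_le x y]

theorem quadratic_le_moreau (x y : E n) :
    moreau X F t x + 1 / t * inner ℝ (x - prox X F t x) (y - x) - 4 / t * ‖y - x‖ ^ 2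
      ≤ moreau X F t y := by
  have h₁ := h.moreau_le_quadratic y x
  have ht := h.t_pos
  have h₂ : inner ℝ ((x - prox X F t x) - (y - prox X F t y)) (y - x) ≤ 3 * ‖y - x‖ ^ 2 := by
    refine (real_inner_le_norm _ _).trans ?_
    have := h.norm_residual_sub_le x y
    rw [norm_sub_rev x y] at this
    nlinarith [norm_nonneg (y - x)]
  rw [inner_sub_left] at h₂
  have h₃ := mul_le_mul_of_nonneg_left h₂ (one_div_pos.2 ht).le
  have e₁ : inner ℝ (y - prox X F t y) (x - y) = - inner ℝ (y - prox X F t y) (y - x) := by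
    rw [← inner_neg_right, neg_sub]
  rw [e₁, norm_sub_rev x y] at h₁
  have e₂ : ‖y - x‖ ^ 2 / (2 * t) ≤ 1 / t * ‖y - x‖ ^ 2 := by
    rw [div_mul_eq_mul_div, one_mul]
    exact div_le_div_of_nonneg_left (sq_nonneg _) ht (by linarith)
  have e₃ : 4 / t * ‖y - x‖ ^ 2 = 1 / t * (3 * ‖y - x‖ ^ 2) + 1 / t * ‖y - x‖ ^ 2 := by ring
  linarith

theorem hasGradientAt_moreau (x : E n) :
    HasGradientAt (moreau X F t) ((1 / t) • (x - prox X F t x)) x := by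
  have ht := h.t_pos
  rw [hasGradientAt_iff_isLittleO]
  refine Asymptotics.IsBigO.trans_isLittleO (g := fun y => ‖y - x‖ ^ 2) ?_ ?_
  · refine Asymptotics.IsBigO.of_bound (4 / t) (Eventually.of_forall fun y => ?_)
    rw [real_inner_smul_left, Real.norm_eq_abs, Real.norm_eq_abs, abs_of_nonneg (sq_nonneg ‖y - x‖),
      abs_le]
    have h₁ := h.moreau_le_quadratic x y
    have h₂ := h.quadratic_le_moreau x y
    have e₂ : ‖y - x‖ ^ 2 / (2 * t) ≤ 4 / t * ‖y - x‖ ^ 2 := by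
      rw [div_mul_eq_mul_div, div_le_div_iff₀ (by positivity) ht]
      nlinarith [mul_nonneg (sq_nonneg ‖y - x‖) ht.le]
    constructor <;> linarith
  · have : (fun y => ‖y - x‖ ^ 2) =o[𝓝 x] fun y => ‖y - x‖ ^ 1 :=
      (Asymptotics.isLittleO_pow_pow (𝕜 := ℝ) one_lt_two).comp_tendsto
        (by simpa using (show Continuous fun y : E n => ‖y - x‖ by fun_prop).tendsto x)
    simpa using this.trans_isBigO (by simpa using Asymptotics.isBigO_refl _ _)

theorem differentiable_moreau : Differentiable ℝ (moreau X F t) :=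
  fun x => (h.hasGradientAt_moreau x).differentiableAt

theorem gradient_moreau (x : E n) :
    gradient (moreau X F t) x = (1 / t) • (x - prox X F t x) :=
  (h.hasGradientAt_moreau x).gradient

theorem norm_gradient_moreau (x : E n) :
    ‖gradient (moreau X F t) x‖ = 1 / t * ‖prox X F t x - x‖ := by
  rw [h.gradient_moreau, norm_smul, Real.norm_eq_abs, abs_of_pos (one_div_pos.2 h.t_pos),
    norm_sub_rev]

end IsRegular

end Moreau

/-! ### Geometric mixing of connected networks -/

section Mixing

variable {N : ℕ} {A : ℕ → Matrix (Fin N) (Fin N) ℝ} {η : ℝ} {B : ℕ}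

theorem transition_add (A : ℕ → Matrix (Fin N) (Fin N) ℝ) (s m m' : ℕ) :
    transition A s (m + m' + 1) = transition A (s + m + 1) m' * transition A s m := by
  induction m' with
  | zero => rfl
  | succ m' ih =>
    change A (s + (m + m' + 1) + 1) * transition A s (m + m' + 1)
      = A (s + m + 1 + m' + 1) * transition A (s + m + 1) m' * transition A s m
    rw [ih, Matrix.mul_assoc]
    congr 2
    omega

theorem transition_mem_doublyStochastic (hA : ∀ k, A k ∈ doublyStochastic ℝ (Fin N)) (s m : ℕ) :
    transition A s m ∈ doublyStochastic ℝ (Fin N) := by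
  induction m with
  | zero => exact hA s
  | succ m ih => exact mul_mem (hA _) ih

/-- A path leaving a set crosses its boundary. -/
theorem exists_exit_of_reflTransGen {ι : Type*} {r : ι → ι → Prop} {S : Set ι} {a b : ι}
    (h : Relation.ReflTransGen r a b) (ha : a ∈ S) (hb : b ∉ S) :
    ∃ p ∈ S, ∃ q ∉ S, r p q := by
  induction h with
  | refl => exact absurd ha hb
  | @tail c d _ hcd ih =>
    by_cases hc : c ∈ S
    · exact ⟨c, hc, d, hb, hcd⟩
    · exact ih hc

/-- A row-stochastic matrix whose entries are at least `ε` shrinks the oscillation of a vector by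
the factor `1 - ε`. -/
theorem osc_mulVec_le {P : Matrix (Fin N) (Fin N) ℝ} {ε d : ℝ} (hP : ∀ i, ∑ j, P i j = 1)
    (hε : 0 ≤ ε) (hPε : ∀ i j, ε ≤ P i j) {y : Fin N → ℝ} (hd : ∀ i i', y i - y i' ≤ d)
    (i i' : Fin N) : ∑ j, P i j * y j - ∑ j, P i' j * y j ≤ (1 - ε) * d := by
  obtain ⟨l, -, hl⟩ := Finset.exists_min_image Finset.univ y ⟨i, Finset.mem_univ i⟩
  have h₁ : y l ≤ ∑ j, P i' j * y j := by
    rw [← one_mul (y l), ← hP i', Finset.sum_mul]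
    exact Finset.sum_le_sum fun j _ =>
      mul_le_mul_of_nonneg_left (hl j (Finset.mem_univ j)) (hε.trans (hPε i' j))
  have hd₀ : 0 ≤ d := by simpa using hd i i
  -- every term of the sum is nonpositive, and the one at the minimiser `l` is at most `-ε d`
  have h₂ : ∑ j, P i j * (y j - y l - d) ≤ -(ε * d) := by
    have hnp : ∀ j ∈ Finset.univ, 0 ≤ -(P i j * (y j - y l - d)) := fun j _ => by
      have := mul_nonneg (hε.trans (hPε i j)) (sub_nonneg.2 (hd j l))
      linarith
    have := Finset.single_le_sum hnp (Finset.mem_univ l)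
    rw [Finset.sum_neg_distrib] at this
    have := mul_le_mul_of_nonneg_right (hPε i l) hd₀
    linarith
  have h₃ : ∑ j, P i j * (y j - y l - d) = ∑ j, P i j * y j - (y l + d) := by
    simp only [mul_sub, Finset.sum_sub_distrib, ← Finset.sum_mul, hP i]
    ring
  linarith

namespace IsNetwork

variable (h : IsNetwork A η B)

include h

theorem eta_le_one (i : Fin N) : η ≤ 1 :=
  (h.self_weight 0 i).trans (le_one_of_mem_doublyStochastic (h.doublyStochastic 0))

theorem transition_nonneg (s m : ℕ) (i j : Fin N) : 0 ≤ transition A s m i j :=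
  nonneg_of_mem_doublyStochastic (transition_mem_doublyStochastic h.doublyStochastic s m)

theorem transition_pos_of_pos {s m : ℕ} {i l j : Fin N} (h₁ : 0 < A (s + m + 1) i l)
    (h₂ : 0 < transition A s m l j) : 0 < transition A s (m + 1) i j := by
  change 0 < ∑ l, A (s + m + 1) i l * transition A s m l j
  exact Finset.sum_pos'
    (fun l _ => mul_nonneg (nonneg_of_mem_doublyStochastic (h.doublyStochastic _))
      (h.transition_nonneg _ _ _ _)) ⟨l, Finset.mem_univ l, mul_pos h₁ h₂⟩

theorem transition_pos_mono {s m m' : ℕ} (hm : m ≤ m') {i j : Fin N}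
    (h₁ : 0 < transition A s m i j) : 0 < transition A s m' i j := by
  induction m', hm using Nat.le_induction with
  | base => exact h₁
  | succ m' _ ih => exact h.transition_pos_of_pos (h.eta_pos.trans_le (h.self_weight _ i)) ih

theorem pow_le_transition {s m : ℕ} {i j : Fin N} (h₁ : 0 < transition A s m i j) :
    η ^ (m + 1) ≤ transition A s m i j := by
  induction m generalizing i with
  | zero =>
    rcases h.weight s i j with h₀ | h₀
    · exact absurd h₁ (by change ¬ 0 < A s i j; rw [h₀]; exact lt_irrefl _)
    · simpa [transition] using h₀
  | succ m ih =>
    change 0 < ∑ l, A (s + m + 1) i l * transition A s m l j at h₁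
    change _ ≤ ∑ l, A (s + m + 1) i l * transition A s m l j
    obtain ⟨l, -, hl⟩ := Finset.exists_lt_of_sum_lt
      (f := fun _ : Fin N => (0 : ℝ)) (s := Finset.univ) (by simpa using h₁)
    have hA : 0 ≤ A (s + m + 1) i l := nonneg_of_mem_doublyStochastic (h.doublyStochastic _)
    have hT := h.transition_nonneg s m l j
    have hA' : η ≤ A (s + m + 1) i l := by
      rcases h.weight (s + m + 1) i l with h₀ | h₀
      · rw [h₀, zero_mul] at hl; exact absurd hl (lt_irrefl _)
      · exact h₀
    have hT' : 0 < transition A s m l j := by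
      rcases hT.eq_or_lt with h₀ | h₀
      · rw [← h₀, mul_zero] at hl; exact absurd hl (lt_irrefl _)
      · exact h₀
    calc η ^ (m + 1 + 1) = η * η ^ (m + 1) := pow_succ' _ _
      _ ≤ A (s + m + 1) i l * transition A s m l j :=
        mul_le_mul hA' (ih hT') (pow_nonneg h.eta_pos.le _) hA
      _ ≤ _ := Finset.single_le_sum
        (f := fun l => A (s + m + 1) i l * transition A s m l j)
        (fun l _ => mul_nonneg (nonneg_of_mem_doublyStochastic (h.doublyStochastic _))
          (h.transition_nonneg _ _ _ _)) (Finset.mem_univ l)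

open Classical in
/-- Over each block of `B` times the set of agents reached from `j` grows until it is everything. -/
theorem card_reached {s m k : ℕ} (hk : s + m + 1 = k * B) (j : Fin N) (r : ℕ) :
    min N (r + 1) ≤ (Finset.univ.filter fun i => 0 < transition A s (m + r * B) i j).card := by
  have hself : ∀ r, 0 < transition A s (m + r * B) j j := fun r =>
    h.transition_pos_mono (Nat.zero_le _) (h.eta_pos.trans_le (h.self_weight s j))
  induction r with
  | zero =>
    refine (min_le_right _ _).trans (Finset.card_pos.2 ⟨j, ?_⟩)
    simpa using hself 0
  | succ r ih =>
    set R : ℕ → Finset (Fin N) := fun m' => Finset.univ.filter fun i => 0 < transition A s m' i j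
      with hR
    change min N (r + 1) ≤ (R (m + r * B)).card at ih
    change min N (r + 1 + 1) ≤ (R (m + (r + 1) * B)).card
    have hmono : ∀ {a b}, a ≤ b → R a ⊆ R b := fun hab i hi => by
      simp only [hR, Finset.mem_filter, Finset.mem_univ, true_and] at hi ⊢
      exact h.transition_pos_mono hab hi
    have hle : m + r * B ≤ m + (r + 1) * B := by
      rw [add_mul]; omega
    by_cases hfull : R (m + r * B) = Finset.univ
    · have := Finset.card_le_card (hmono hle)
      rw [hfull, Finset.card_univ, Fintype.card_fin] at this
      exact (min_le_left _ _).trans this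
    · obtain ⟨i, hi⟩ : ∃ i, i ∉ R (m + r * B) := by
        by_contra! hc
        exact hfull (Finset.eq_univ_iff_forall.2 hc)
      obtain ⟨p, hp, q, hq, l, hl₁, hl₂, hl₃⟩ := exists_exit_of_reflTransGen
        (S := (R (m + r * B) : Set (Fin N))) (h.connected (k + r) j i)
        (by simpa [hR] using hself r) (by simpa using hi)
      obtain ⟨d, rfl⟩ : ∃ d, l = s + (m + r * B + d) + 1 := by
        refine ⟨l - (s + m + r * B + 1), ?_⟩
        rw [add_mul] at hl₁; omega
      have hd : m + r * B + d + 1 ≤ m + (r + 1) * B := by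
        have e₁ : (k + r + 1) * B = k * B + r * B + B := by ring
        have e₂ : (r + 1) * B = r * B + B := by ring
        omega
      have hq' : q ∈ R (m + (r + 1) * B) := by
        refine hmono hd ?_
        have hp' := hmono (Nat.le_add_right (m + r * B) d) hp
        simp only [hR, Finset.mem_filter, Finset.mem_univ, true_and] at hp' ⊢
        exact h.transition_pos_of_pos hl₃ hp'
      have hlt : (R (m + r * B)).card < (R (m + (r + 1) * B)).card :=
        Finset.card_lt_card ⟨hmono hle, fun hsub => hq (by simpa using hsub hq')⟩
      omega

/-- All entries of a product over a window of `(N + 1) B` times are bounded away from `0`. -/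
theorem pow_le_transition_window (s : ℕ) (i j : Fin N) :
    η ^ ((N + 1) * B) ≤ transition A s ((N + 1) * B - 1) i j := by
  classical
  have hB := h.B_pos
  -- the first block that starts after time `s` starts at time `s + m + 1`
  obtain ⟨m, hm, hmB⟩ : ∃ m, s + m + 1 = (s / B + 1) * B ∧ m + 1 ≤ B := by
    have h₁ := Nat.div_add_mod s B
    have h₂ := Nat.mod_lt s hB
    have e : (s / B + 1) * B = B * (s / B) + B := by ring
    exact ⟨B - 1 - s % B, by omega, by omega⟩
  have hcard := h.card_reached hm j N
  rw [min_eq_left (Nat.le_succ N)] at hcard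
  have huniv : (Finset.univ.filter fun i => 0 < transition A s (m + N * B) i j) = Finset.univ :=
    Finset.eq_univ_of_card _ (le_antisymm (Finset.card_le_univ _) (by simpa using hcard))
  have hpos : 0 < transition A s (m + N * B) i j := by
    have := Finset.mem_univ i
    rw [← huniv] at this
    simpa using this
  have e : (N + 1) * B = N * B + B := by ring
  have := h.pow_le_transition (h.transition_pos_mono (m' := (N + 1) * B - 1) (by omega) hpos)
  rwa [Nat.sub_add_cancel (by omega)] at this

theorem osc_transition_le {ε : ℝ} (hε : 0 ≤ ε) (hε' : ε ≤ η ^ ((N + 1) * B)) (s m r : ℕ)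
    (i i' j : Fin N) :
    transition A s (m + (N + 1) * B * r) i j - transition A s (m + (N + 1) * B * r) i' j
      ≤ (1 - ε) ^ r := by
  have hds := transition_mem_doublyStochastic h.doublyStochastic
  induction r generalizing i i' with
  | zero =>
    have h₁ := le_one_of_mem_doublyStochastic (hds s m) (i := i) (j := j)
    have h₂ := h.transition_nonneg s m i' j
    simpa using by linarith
  | succ r ih =>
    have hW : 0 < (N + 1) * B := Nat.mul_pos (Nat.succ_pos N) h.B_pos
    have e : m + (N + 1) * B * (r + 1)
        = (m + (N + 1) * B * r) + ((N + 1) * B - 1) + 1 := by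
      rw [mul_add]; omega
    rw [e, transition_add, pow_succ', Matrix.mul_apply, Matrix.mul_apply]
    exact osc_mulVec_le (fun i => sum_row_of_mem_doublyStochastic (hds _ _) i) hε
      (fun i j => hε'.trans (h.pow_le_transition_window _ i j)) ih i i'

theorem exists_entry_bound (hN : 0 < N) : ∃ K lam : ℝ, 0 < K ∧ 0 < lam ∧ lam < 1 ∧
    ∀ s m i j, |transition A s m i j - 1 / (N : ℝ)| ≤ K * lam ^ m := by
  set W := (N + 1) * B with hW
  have hW₀ : 0 < W := Nat.mul_pos (Nat.succ_pos N) h.B_pos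
  -- half of the lower bound, so that `1 - ε` stays positive
  set ε := η ^ W / 2 with hε
  have hε₀ : 0 < ε := by have := pow_pos h.eta_pos W; positivity
  have hε₁ : ε < 1 := by
    have := pow_le_one₀ (n := W) h.eta_pos.le (h.eta_le_one ⟨0, hN⟩)
    linarith
  set lam := (1 - ε) ^ ((W : ℝ)⁻¹) with hlam
  have hlam₀ : 0 < lam := Real.rpow_pos_of_pos (by linarith) _
  have hlam₁ : lam < 1 := Real.rpow_lt_one (by linarith) (by linarith) (by positivity)
  have hlamW : lam ^ W = 1 - ε := Real.rpow_inv_natCast_pow (by linarith) hW₀.ne'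
  refine ⟨(lam ^ W)⁻¹, lam, by positivity, hlam₀, hlam₁, fun s m i j => ?_⟩
  have hosc : ∀ i i', transition A s m i j - transition A s m i' j ≤ (lam ^ W)⁻¹ * lam ^ m := by
    intro i i'
    have h₁ := h.osc_transition_le hε₀.le (by linarith) s (m % W) (m / W) i i' j
    rw [← hW, Nat.mod_add_div, ← hlamW, ← pow_mul] at h₁
    refine h₁.trans ?_
    rw [inv_mul_eq_div, le_div_iff₀ (by positivity), ← pow_add]
    refine pow_le_pow_of_le_one hlam₀.le hlam₁.le ?_
    have := Nat.mod_add_div m W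
    have := Nat.mod_lt m hW₀
    omega
  have hN' : (0 : ℝ) < N := Nat.cast_pos.2 hN
  have hcol := sum_col_of_mem_doublyStochastic
    (transition_mem_doublyStochastic h.doublyStochastic s m) j
  set K := (lam ^ W)⁻¹ * lam ^ m
  have e : N * (transition A s m i j - 1 / (N : ℝ))
      = ∑ i', (transition A s m i j - transition A s m i' j) := by
    rw [Finset.sum_sub_distrib, hcol]
    simp
    field_simp
  have h₁ : N * (transition A s m i j - 1 / (N : ℝ)) ≤ N * K := by
    rw [e]
    simpa using Finset.sum_le_card_nsmul Finset.univ _ K fun i' _ => hosc i i'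
  have h₂ : N * -K ≤ N * (transition A s m i j - 1 / (N : ℝ)) := by
    rw [e]
    simpa using Finset.card_nsmul_le_sum Finset.univ
      (fun i' => transition A s m i j - transition A s m i' j) (-K)
      fun i' _ => by linarith [hosc i' i]
  exact abs_le.2 ⟨le_of_mul_le_mul_left h₂ hN', le_of_mul_le_mul_left h₁ hN'⟩

end IsNetwork

theorem norm_toEuclideanCLM_le {M : Matrix (Fin N) (Fin N) ℝ} {e : ℝ} (he : 0 ≤ e)
    (hM : ∀ i j, |M i j| ≤ e) :
    ‖Matrix.toEuclideanCLM (n := Fin N) (𝕜 := ℝ) M‖ ≤ N * (N * e) := by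
  refine ContinuousLinearMap.opNorm_le_bound _ (by positivity) fun x => ?_
  have hcoord : ∀ i, ‖(Matrix.toEuclideanCLM (n := Fin N) (𝕜 := ℝ) M x) i‖ ≤ N * e * ‖x‖ := by
    intro i
    rw [Matrix.ofLp_toEuclideanCLM]
    change ‖∑ j, M i j * x j‖ ≤ _
    refine (norm_sum_le_of_le (f := fun j => M i j * x j) (n := fun _ => e * ‖x‖) Finset.univ
      fun j _ => ?_).trans_eq ?_
    · rw [norm_mul]
      exact mul_le_mul (hM i j) (PiLp.norm_apply_le x j) (norm_nonneg _) he
    · simp [mul_assoc]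
  have hsq : ‖Matrix.toEuclideanCLM (n := Fin N) (𝕜 := ℝ) M x‖ ≤
      ∑ i, ‖(Matrix.toEuclideanCLM (n := Fin N) (𝕜 := ℝ) M x) i‖ := by
    rw [EuclideanSpace.norm_eq]
    refine Real.sqrt_le_iff.2 ⟨Finset.sum_nonneg fun i _ => norm_nonneg _, ?_⟩
    exact Finset.sum_sq_le_sq_sum_of_nonneg fun i _ => norm_nonneg _
  refine hsq.trans ((Finset.sum_le_card_nsmul _ _ _ fun i _ => hcoord i).trans_eq ?_)
  simp only [Finset.card_univ, Fintype.card_fin, nsmul_eq_mul]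
  ring

theorem abs_entry_le_norm_toEuclideanCLM (M : Matrix (Fin N) (Fin N) ℝ) (i j : Fin N) :
    |M i j| ≤ ‖Matrix.toEuclideanCLM (n := Fin N) (𝕜 := ℝ) M‖ := by
  have h₁ := (Matrix.toEuclideanCLM (n := Fin N) (𝕜 := ℝ) M).le_opNorm
    (EuclideanSpace.single j (1 : ℝ))
  have h₂ := PiLp.norm_apply_le
    (Matrix.toEuclideanCLM (n := Fin N) (𝕜 := ℝ) M (EuclideanSpace.single j (1 : ℝ))) i
  rw [Matrix.ofLp_toEuclideanCLM] at h₂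
  simp at h₁ h₂
  exact h₂.trans h₁

theorem IsNetwork.exists_isMixing (h : IsNetwork A η B) (hN : 0 < N) :
    ∃ c lam : ℝ, 0 < c ∧ 0 < lam ∧ lam < 1 ∧ IsMixing A c lam := by
  obtain ⟨K, lam, hK, hl₀, hl₁, hb⟩ := h.exists_entry_bound hN
  have hN' : (0 : ℝ) < N := Nat.cast_pos.2 hN
  refine ⟨N * (N * K), lam, by positivity, hl₀, hl₁, fun s m => ?_⟩
  refine (norm_toEuclideanCLM_le (e := K * lam ^ m) (by positivity) fun i j => ?_).trans_eq
    (by ring)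
  simpa using hb s m i j

theorem IsMixing.abs_entry_le {c lam : ℝ} (h : IsMixing A c lam) (s m : ℕ) (i j : Fin N) :
    |transition A s m i j - 1 / (N : ℝ)| ≤ c * lam ^ m := by
  simpa using (abs_entry_le_norm_toEuclideanCLM
    (transition A s m - Matrix.of fun _ _ => 1 / (N : ℝ)) i j).trans (h s m)

end Mixing

/-! ### Averages, stochastic matrices and geometric convolutions -/

section Consensus

variable {n N : ℕ}

/-- The action of an `N × N` matrix on an `N`-tuple of vectors. -/
noncomputable def act (M : Matrix (Fin N) (Fin N) ℝ) (x : Fin N → E n) (i : Fin N) : E n :=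
  ∑ j, M i j • x j

/-- The average of an `N`-tuple of vectors. -/
noncomputable def avg (x : Fin N → E n) : E n := (1 / (N : ℝ)) • ∑ i, x i

theorem act_mul (M P : Matrix (Fin N) (Fin N) ℝ) (x : Fin N → E n) :
    act (M * P) x = act M (act P x) := by
  ext1 i
  simp only [act, Matrix.mul_apply, Finset.sum_smul, Finset.smul_sum, smul_smul]
  exact Finset.sum_comm

theorem act_add (M : Matrix (Fin N) (Fin N) ℝ) (x y : Fin N → E n) (i : Fin N) :
    act M (x + y) i = act M x i + act M y i := by
  simp [act, Finset.sum_add_distrib]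

theorem avg_add (x y : Fin N → E n) : avg (x + y) = avg x + avg y := by
  simp [avg, Finset.sum_add_distrib]

theorem sum_act {M : Matrix (Fin N) (Fin N) ℝ} (hM : M ∈ doublyStochastic ℝ (Fin N))
    (x : Fin N → E n) : ∑ i, act M x i = ∑ i, x i := by
  simp only [act]
  rw [Finset.sum_comm]
  simp only [← Finset.sum_smul, sum_col_of_mem_doublyStochastic hM, one_smul]

theorem avg_act {M : Matrix (Fin N) (Fin N) ℝ} (hM : M ∈ doublyStochastic ℝ (Fin N))
    (x : Fin N → E n) : avg (act M x) = avg x := by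
  rw [avg, sum_act hM, avg]

theorem sum_sub_avg (x : Fin N → E n) (hN : 0 < N) : ∑ i, (x i - avg x) = 0 := by
  have hN' : (N : ℝ) ≠ 0 := (Nat.cast_pos.2 hN).ne'
  simp [avg, Finset.sum_sub_distrib, ← Nat.cast_smul_eq_nsmul ℝ, smul_smul, mul_inv_cancel₀ hN']

theorem norm_avg_le {x : Fin N → E n} {r : ℝ} (hN : 0 < N) (hx : ∀ i, ‖x i‖ ≤ r) :
    ‖avg x‖ ≤ r := by
  have hN' : (0 : ℝ) < N := Nat.cast_pos.2 hN
  rw [avg, norm_smul, Real.norm_eq_abs, abs_of_pos (by positivity), one_div,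
    inv_mul_le_iff₀ hN']
  simpa using norm_sum_le_of_le (n := fun _ => r) Finset.univ fun i _ => hx i

/-- A matrix whose entries are within `b` of `1/N` maps a tuple near its average. -/
theorem norm_act_sub_avg_le {M : Matrix (Fin N) (Fin N) ℝ} {x : Fin N → E n} {b r : ℝ}
    (hM : ∀ i j, |M i j - 1 / (N : ℝ)| ≤ b) (hx : ∀ j, ‖x j‖ ≤ r) (i : Fin N) :
    ‖act M x i - avg x‖ ≤ N * b * r := by
  have e : act M x i - avg x = ∑ j, (M i j - 1 / (N : ℝ)) • x j := by
    simp only [act, avg, Finset.smul_sum, sub_smul, Finset.sum_sub_distrib]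
  rw [e]
  refine (norm_sum_le_of_le (n := fun _ => b * r) Finset.univ fun j _ => ?_).trans_eq ?_
  · rw [norm_smul]
    exact mul_le_mul (hM i j) (hx j) (norm_nonneg _) ((abs_nonneg _).trans (hM i j))
  · simp [mul_assoc]

/-- Averaging with stochastic weights does not increase the distance to a point. -/
theorem norm_act_sub_le {M : Matrix (Fin N) (Fin N) ℝ} (hM : M ∈ doublyStochastic ℝ (Fin N))
    {x : Fin N → E n} {z : E n} {r : ℝ} (hx : ∀ j, ‖x j - z‖ ≤ r) (i : Fin N) :
    ‖act M x i - z‖ ≤ r := by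
  have hrow := sum_row_of_mem_doublyStochastic hM i
  have e : act M x i - z = ∑ j, M i j • (x j - z) := by
    simp only [act, smul_sub, Finset.sum_sub_distrib, ← Finset.sum_smul, hrow, one_smul]
  rw [e]
  refine (norm_sum_le_of_le (n := fun j => M i j * r) Finset.univ fun j _ => ?_).trans_eq ?_
  · rw [norm_smul, Real.norm_eq_abs, abs_of_nonneg (nonneg_of_mem_doublyStochastic hM)]
    exact mul_le_mul_of_nonneg_left (hx j) (nonneg_of_mem_doublyStochastic hM)
  · rw [← Finset.sum_mul, hrow, one_mul]

theorem act_mem {M : Matrix (Fin N) (Fin N) ℝ} (hM : M ∈ doublyStochastic ℝ (Fin N))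
    {X : Set (E n)} (hX : Convex ℝ X) {x : Fin N → E n} (hx : ∀ j, x j ∈ X) (i : Fin N) :
    act M x i ∈ X :=
  hX.sum_mem (fun _ _ => nonneg_of_mem_doublyStochastic hM)
    (sum_row_of_mem_doublyStochastic hM i) fun j _ => hx j

theorem avg_mem (hN : 0 < N) {X : Set (E n)} (hX : Convex ℝ X) {x : Fin N → E n}
    (hx : ∀ j, x j ∈ X) : avg x ∈ X := by
  have hN' : (N : ℝ) ≠ 0 := (Nat.cast_pos.2 hN).ne'
  rw [avg, Finset.smul_sum]
  exact hX.sum_mem (fun _ _ => by positivity) (by simp [hN']) fun j _ => hx j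

/-- The solution of the recursion `u (k + 1) = lam * u k + β k` with `u 0 = u₀`, that is, the
convolution of `β` with the powers of `lam`, plus a geometric transient. -/
def geomConv (lam u₀ : ℝ) (β : ℕ → ℝ) : ℕ → ℝ
  | 0 => u₀
  | k + 1 => lam * geomConv lam u₀ β k + β k

/-- Young's inequality for the convolution with a geometric kernel, with the transient. -/
theorem sum_geomConv_sq_le {lam u₀ : ℝ} {β : ℕ → ℝ} (h₀ : 0 < lam) (h₁ : lam < 1) (T : ℕ) :
    ∑ k ∈ Finset.range T, geomConv lam u₀ β k ^ 2
      ≤ u₀ ^ 2 / (1 - lam) + 1 / (1 - lam) ^ 2 * ∑ k ∈ Finset.range T, β k ^ 2 := by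
  have hl : 0 < 1 - lam := sub_pos.2 h₁
  have key : (1 - lam) * ∑ k ∈ Finset.range T, geomConv lam u₀ β k ^ 2 + geomConv lam u₀ β T ^ 2
      ≤ u₀ ^ 2 + 1 / (1 - lam) * ∑ k ∈ Finset.range T, β k ^ 2 := by
    induction T with
    | zero => simp [geomConv]
    | succ T ih =>
      rw [Finset.sum_range_succ, Finset.sum_range_succ]
      have hstep : geomConv lam u₀ β (T + 1) ^ 2
          ≤ lam * geomConv lam u₀ β T ^ 2 + 1 / (1 - lam) * β T ^ 2 := by
        change (lam * geomConv lam u₀ β T + β T) ^ 2 ≤ _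
        set u := geomConv lam u₀ β T
        have e : lam * u ^ 2 + 1 / (1 - lam) * β T ^ 2 - (lam * u + β T) ^ 2
            = lam / (1 - lam) * ((1 - lam) * u - β T) ^ 2 := by
          field_simp; ring
        have : 0 ≤ lam / (1 - lam) * ((1 - lam) * u - β T) ^ 2 := by positivity
        linarith
      linarith
  have h₂ : (1 - lam) * ∑ k ∈ Finset.range T, geomConv lam u₀ β k ^ 2
      ≤ u₀ ^ 2 + 1 / (1 - lam) * ∑ k ∈ Finset.range T, β k ^ 2 := by
    linarith [sq_nonneg (geomConv lam u₀ β T)]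
  rw [← le_div_iff₀' hl] at h₂
  refine h₂.trans_eq ?_
  field_simp

end Consensus

/-! ### One step of the method -/

section Run

variable {n N : ℕ} {X : Set (E n)} {f : Fin N → E n → ℝ} {ρ t : ℝ} {L : NNReal}

theorem IsProj.norm_sub_le {z p y : E n} (hX : Convex ℝ X) (h : IsProj X z p) (hy : y ∈ X) :
    ‖y - p‖ ≤ ‖y - z‖ := by
  have hin : 2 * inner ℝ (z - p) (y - p) ≤ 0 := by
    refine le_of_forall_small_mul (K := ‖y - p‖ ^ 2) fun s hs hs₁ => ?_
    have h₁ := h.2 _ (hX.add_smul_sub_mem h.1 hy ⟨hs.le, hs₁⟩)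
    have h₂ := pow_le_pow_left₀ (norm_nonneg _) h₁ 2
    rw [← sub_sub, norm_sub_sq_real (z - p), real_inner_smul_right, norm_smul, mul_pow,
      Real.norm_eq_abs, sq_abs] at h₂
    refine le_of_mul_le_mul_left ?_ hs
    linarith
  have e : ‖y - z‖ ^ 2 = ‖y - p‖ ^ 2 - 2 * inner ℝ (z - p) (y - p) + ‖z - p‖ ^ 2 := by
    rw [real_inner_comm, ← norm_sub_sq_real]; congr 2; abel
  refine le_of_sq_le_sq ?_ (norm_nonneg _)
  linarith [sq_nonneg ‖z - p‖]

theorem sum_objective (f : Fin N → E n → ℝ) (hN : 0 < N) (x : E n) :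
    ∑ i, f i x = N * objective f x := by
  have hN' : (N : ℝ) ≠ 0 := (Nat.cast_pos.2 hN).ne'
  rw [objective]; field_simp

namespace IsProblem

variable (H : IsProblem X f ρ L)

include H

theorem isRegular (hN : 0 < N) (hρ : 0 < ρ) (ht : 0 < t) (htρ : t < 1 / (2 * ρ)) :
    IsRegular X (objective f) ρ t L where
  nonempty := H.nonempty
  isClosed := H.isClosed
  convex := H.convex
  bddBelow := H.bddBelow
  t_pos := ht
  rho_pos := hρ
  rho_mul_t := by rw [lt_div_iff₀ (by positivity)] at htρ; linarith
  weaklyConvex := by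
    have hN' : (0 : ℝ) < N := Nat.cast_pos.2 hN
    have hs : ConvexOn ℝ Set.univ (∑ i, fun x => f i x + ρ / 2 * ‖x‖ ^ 2) :=
      Finset.sum_induction _ (ConvexOn ℝ Set.univ) (fun _ _ ha hb => ha.add hb)
        (convexOn_const 0 convex_univ) fun i _ => H.weaklyConvex i
    have := hs.smul (one_div_pos.2 hN').le
    refine this.congr fun x _ => ?_
    simp [objective, Finset.sum_add_distrib, mul_add]
    field_simp
  lipschitz := by
    have hN' : (0 : ℝ) < N := Nat.cast_pos.2 hN
    refine LipschitzOnWith.of_dist_le_mul fun x hx y hy => ?_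
    rw [Real.dist_eq, objective, objective, ← mul_sub, ← Finset.sum_sub_distrib, abs_mul,
      abs_of_pos (by positivity), one_div, inv_mul_le_iff₀ hN']
    have hi : ∀ i, |f i x - f i y| ≤ L * dist x y := fun i => by
      simpa [Real.dist_eq] using (H.lipschitz i).dist_le_mul x hx y hy
    exact (Finset.abs_sum_le_sum_abs _ _).trans
      ((Finset.sum_le_sum fun i _ => hi i).trans_eq (by simp))

theorem abs_sub_le (i : Fin N) {x y : E n} (hx : x ∈ X) (hy : y ∈ X) :
    |f i x - f i y| ≤ L * ‖x - y‖ := by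
  simpa [Real.dist_eq, dist_eq_norm] using (H.lipschitz i).dist_le_mul x hx y hy

/-- Projected subgradient step of one agent, in terms of the Moreau envelope of the objective. -/
theorem moreau_step_le (h : IsRegular X (objective f) ρ t L) {i : Fin N} {v g p : E n} {a : ℝ}
    (ha : 0 < a) (hv : v ∈ X) (hg : g ∈ subdiff (f i) v) (hp : IsProj X (v - a • g) p) :
    moreau X (objective f) t p ≤ moreau X (objective f) t v
      + a / t * (f i (prox X (objective f) t v) - f i v
        + ρ / 2 * ‖prox X (objective f) t v - v‖ ^ 2) + a ^ 2 * L ^ 2 / (2 * t) := by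
  have ht := h.t_pos
  have h₁ := h.moreau_le p (h.prox_mem v)
  have h₂ := hp.norm_sub_le h.convex (h.prox_mem v)
  have h₃ := (H.weaklyConvex i).subgradient_inequality hg (prox X (objective f) t v)
  rw [h.moreau_eq v]
  set q := prox X (objective f) t v
  have h₄ : ‖g‖ ≤ L := H.subgradient_le i v hv g hg
  have h₅ : ‖q - p‖ ^ 2 ≤ ‖q - v‖ ^ 2 + 2 * a * inner ℝ g (q - v) + a ^ 2 * L ^ 2 := by
    refine (pow_le_pow_left₀ (norm_nonneg _) h₂ 2).trans ?_
    rw [← sub_add, norm_add_sq_real, real_inner_smul_right, norm_smul, mul_pow,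
      Real.norm_eq_abs, sq_abs, real_inner_comm]
    have := mul_le_mul_of_nonneg_left (pow_le_pow_left₀ (norm_nonneg _) h₄ 2) (sq_nonneg a)
    linarith
  have h₆ : ‖q - p‖ ^ 2 / (2 * t) ≤ ‖q - v‖ ^ 2 / (2 * t)
      + a / t * inner ℝ g (q - v) + a ^ 2 * L ^ 2 / (2 * t) := by
    refine (div_le_div_of_nonneg_right h₅ (by positivity)).trans_eq ?_
    field_simp
  have := mul_le_mul_of_nonneg_left h₃ (div_pos ha ht).le
  linarith

/-- The decrease at `v` and the decrease at `z` differ by `O(L ‖v - z‖)`. -/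
theorem decrease_le (h : IsRegular X (objective f) ρ t L) (i : Fin N) {v z : E n} {D : ℝ}
    (hv : v ∈ X) (hz : z ∈ X) (hD : ‖v - z‖ ≤ D) :
    f i (prox X (objective f) t v) - f i v + ρ / 2 * ‖prox X (objective f) t v - v‖ ^ 2
      ≤ f i (prox X (objective f) t z) - f i z + ρ / 2 * ‖prox X (objective f) t z - z‖ ^ 2
        + 6 * L * D := by
  have ht := h.t_pos
  have hρ := h.rho_pos
  have hL : (0 : ℝ) ≤ L := L.2
  have hD₀ := (norm_nonneg _).trans hD
  have h₁ := (abs_le.1 (H.abs_sub_le i (h.prox_mem v) (h.prox_mem z))).2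
  have h₂ := (abs_le.1 (H.abs_sub_le i hv hz)).1
  have h₃ := h.norm_prox_sub_le v z
  have h₄ := h.norm_residual_sub_le v z
  have h₅ := h.norm_prox_sub_self_le hv
  have h₆ := h.norm_prox_sub_self_le hz
  set p := prox X (objective f) t v
  set q := prox X (objective f) t z
  have h₇ : ‖p - v‖ - ‖q - z‖ ≤ 3 * D := by
    rw [norm_sub_rev p, norm_sub_rev q]
    linarith [norm_sub_norm_le (v - p) (z - q)]
  have h₈ : ‖p - v‖ ^ 2 - ‖q - z‖ ^ 2 ≤ 3 * D * (4 * t * L) := by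
    have e : ‖p - v‖ ^ 2 - ‖q - z‖ ^ 2 = (‖p - v‖ - ‖q - z‖) * (‖p - v‖ + ‖q - z‖) := by ring
    rw [e]
    exact mul_le_mul h₇ (by linarith) (by positivity) (by positivity)
  have h₉ : ρ / 2 * (‖p - v‖ ^ 2 - ‖q - z‖ ^ 2) ≤ 3 * (L * D) := by
    have := mul_le_mul_of_nonneg_left h₈ (by positivity : 0 ≤ ρ / 2)
    have := mul_le_mul_of_nonneg_right h.rho_mul_t.le (mul_nonneg hL hD₀)
    linarith
  have h₁₀ : (L : ℝ) * ‖p - q‖ ≤ L * (2 * D) := mul_le_mul_of_nonneg_left (by linarith) hL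
  have h₁₁ : (L : ℝ) * ‖v - z‖ ≤ L * D := mul_le_mul_of_nonneg_left hD hL
  linarith

end IsProblem

/-- The average envelope value of a tuple of points near their average `z` is the value at `z`, up
to second order: the first-order terms cancel. -/
theorem IsRegular.abs_sum_moreau_sub_le {F : E n → ℝ} (h : IsRegular X F ρ t L)
    {y : Fin N → E n} {z : E n} {D : ℝ}
    (hsum : ∑ i, (y i - z) = 0) (hD : ∀ i, ‖y i - z‖ ≤ D) :
    |∑ i, moreau X F t (y i) - N * moreau X F t z| ≤ N * (4 / t * D ^ 2) := by
  have ht := h.t_pos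
  have hin : ∑ i, (1 / t * inner ℝ (z - prox X F t z) (y i - z) : ℝ) = 0 := by
    rw [← Finset.mul_sum, ← inner_sum, hsum, inner_zero_right, mul_zero]
  have hterm : ∀ i, |moreau X F t (y i) - moreau X F t z
      - 1 / t * inner ℝ (z - prox X F t z) (y i - z)| ≤ 4 / t * D ^ 2 := fun i => by
    have h₁ := h.moreau_le_quadratic z (y i)
    have h₂ := h.quadratic_le_moreau z (y i)
    have h₃ := pow_le_pow_left₀ (norm_nonneg _) (hD i) 2
    have h₄ : 4 / t * ‖y i - z‖ ^ 2 ≤ 4 / t * D ^ 2 :=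
      mul_le_mul_of_nonneg_left h₃ (by positivity)
    have h₅ : ‖y i - z‖ ^ 2 / (2 * t) ≤ 4 / t * ‖y i - z‖ ^ 2 := by
      rw [div_mul_eq_mul_div, div_le_div_iff₀ (by positivity) ht]
      nlinarith [mul_nonneg (sq_nonneg ‖y i - z‖) ht.le]
    rw [abs_le]; constructor <;> linarith
  have e : ∑ i, moreau X F t (y i) - N * moreau X F t z
      = ∑ i, (moreau X F t (y i) - moreau X F t z
        - 1 / t * inner ℝ (z - prox X F t z) (y i - z)) := by
    rw [Finset.sum_sub_distrib, hin, Finset.sum_sub_distrib]; simp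
  rw [e]
  exact (Finset.abs_sum_le_sum_abs _ _).trans
    ((Finset.sum_le_sum fun i _ => hterm i).trans_eq (by simp))

namespace IsRun

variable {A : ℕ → Matrix (Fin N) (Fin N) ℝ} {η : ℝ} {B : ℕ} {α : ℕ → ℝ} {x : ℕ → Fin N → E n}
  (R : IsRun X f A α x)

include R

theorem mem (k : ℕ) (i : Fin N) : x k i ∈ X := by
  cases k with
  | zero => exact R.init i
  | succ k => obtain ⟨g, -, hp⟩ := R.step k i; exact hp.1

theorem norm_step_sub_mix_le (H : IsProblem X f ρ L) (hA : IsNetwork A η B) (hα : ∀ k, 0 < α k)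
    (k : ℕ) (i : Fin N) : ‖x (k + 1) i - mix A x k i‖ ≤ L * α k := by
  obtain ⟨g, hg, hp⟩ := R.step k i
  have hv : mix A x k i ∈ X := act_mem (hA.doublyStochastic k) H.convex (R.mem k) i
  have h₁ := hp.norm_sub_le H.convex hv
  rw [norm_sub_rev, sub_sub_cancel, norm_smul, Real.norm_eq_abs, abs_of_pos (hα k)] at h₁
  rw [mul_comm]
  exact h₁.trans (mul_le_mul_of_nonneg_left (H.subgradient_le i _ hv g hg) (hα k).le)

/-- Propagating the iterates through `m + 1` further mixing steps brings them close to their average.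
The extra factor `lam ^ m` makes the statement inductive in `k`. -/
theorem norm_act_transition_sub_le (H : IsProblem X f ρ L) (hA : IsNetwork A η B)
    (hα : ∀ k, 0 < α k) {c lam r : ℝ} (hmix : IsMixing A c lam) (hr : ∀ i, ‖x 0 i‖ ≤ r)
    (k m : ℕ) (i : Fin N) : ‖act (transition A k m) (x k) i - xbar x k‖
      ≤ lam ^ m * geomConv lam (c * N * r) (fun k => c * N * L * α k) k := by
  change ‖act (transition A k m) (x k) i - avg (x k)‖ ≤ _
  induction k generalizing m i with
  | zero =>
    refine (norm_act_sub_avg_le (hmix.abs_entry_le 0 m) hr i).trans_eq ?_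
    simp only [geomConv]; ring
  | succ k ih =>
    set e : Fin N → E n := fun i => x (k + 1) i - mix A x k i
    have hx : x (k + 1) = act (A k) (x k) + e := by
      ext1 i; exact (add_sub_cancel (mix A x k i) (x (k + 1) i)).symm
    have htr : transition A k (m + 1) = transition A (k + 1) m * A k := by
      simpa [transition] using transition_add A k 0 m
    have h₁ := ih (m + 1) i
    have h₂ := norm_act_sub_avg_le (hmix.abs_entry_le (k + 1) m)
      (R.norm_step_sub_mix_le H hA hα k) i
    have e₁ : act (transition A (k + 1) m) (x (k + 1)) i - avg (x (k + 1))
        = (act (transition A k (m + 1)) (x k) i - avg (x k))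
          + (act (transition A (k + 1) m) e i - avg e) := by
      rw [htr, act_mul, hx, act_add, avg_add, avg_act (hA.doublyStochastic k)]
      abel
    rw [e₁]
    refine (norm_add_le _ _).trans ((add_le_add h₁ h₂).trans_eq ?_)
    simp only [geomConv]; ring

/-- Consensus: the distance of the iterates to their average. -/
theorem norm_sub_xbar_le (hN : 0 < N) (H : IsProblem X f ρ L) (hA : IsNetwork A η B)
    (hα : ∀ k, 0 < α k) {c lam r : ℝ} (hmix : IsMixing A c lam) (hr : ∀ i, ‖x 0 i‖ ≤ r)
    (k : ℕ) (i : Fin N) : ‖x (k + 1) i - xbar x (k + 1)‖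
      ≤ geomConv lam (c * N * r) (fun k => c * N * L * α k) k + 2 * (L * α k) := by
  have h₁ := R.norm_act_transition_sub_le H hA hα hmix hr k 0 i
  rw [pow_zero, one_mul] at h₁
  have h₂ := R.norm_step_sub_mix_le H hA hα k
  set e : Fin N → E n := fun i => x (k + 1) i - mix A x k i
  have hx : x (k + 1) = act (A k) (x k) + e := by
    ext1 i; exact (add_sub_cancel (mix A x k i) (x (k + 1) i)).symm
  have e₁ : x (k + 1) i - xbar x (k + 1)
      = (act (transition A k 0) (x k) i - xbar x k) + (e i - avg e) := by
    change x (k + 1) i - avg (x (k + 1)) = (act (A k) (x k) i - avg (x k)) + (e i - avg e)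
    rw [hx, avg_add, avg_act (hA.doublyStochastic k), Pi.add_apply]
    abel
  rw [e₁]
  have h₃ := norm_avg_le hN h₂
  linarith [norm_add_le (act (transition A k 0) (x k) i - xbar x k) (e i - avg e),
    norm_sub_le (e i) (avg e), h₂ i]

/-- One step decreases the average envelope value by a multiple of the squared gradient at the
average, up to the disagreement `D` and the stepsize, both squared. -/
theorem phibar_succ_le (hN : 0 < N) (H : IsProblem X f ρ L)
    (h : IsRegular X (objective f) ρ t L) (hA : IsNetwork A η B) (hα : ∀ k, 0 < α k) {k : ℕ}
    {D : ℝ} (hD : ∀ i, ‖x k i - xbar x k‖ ≤ D) :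
    phibar X f t x (k + 1) + α k / 2 * ‖gradient (moreau X (objective f) t) (xbar x k)‖ ^ 2
      ≤ phibar X f t x k + 12 / t * (D ^ 2 + (L * α k) ^ 2) := by
  have ht := h.t_pos
  have ha := hα k
  have hN' : (0 : ℝ) < N := Nat.cast_pos.2 hN
  have hL : (0 : ℝ) ≤ L := L.2
  have hds := hA.doublyStochastic k
  set z := xbar x k with hz
  set F := objective f with hF
  set v := mix A x k with hv
  have hD₀ : 0 ≤ D := (norm_nonneg _).trans (hD ⟨0, hN⟩)
  have hzX : z ∈ X := avg_mem hN H.convex (R.mem k)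
  have hvX : ∀ i, v i ∈ X := act_mem hds H.convex (R.mem k)
  have hvD : ∀ i, ‖v i - z‖ ≤ D := norm_act_sub_le hds hD
  have hvsum : ∑ i, (v i - z) = 0 := by
    have e : z = avg (act (A k) (x k)) := (avg_act hds (x k)).symm
    rw [e]
    exact sum_sub_avg (act (A k) (x k)) hN
  have hs₁ := (abs_le.1 (h.abs_sum_moreau_sub_le hvsum hvD)).2
  have hs₂ := (abs_le.1 (h.abs_sum_moreau_sub_le (sum_sub_avg (x k) hN) hD)).1
  have hs₂' : -(N * (4 / t * D ^ 2)) ≤ ∑ i, moreau X F t (x k i) - N * moreau X F t z := hs₂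
  set p := prox X F t z with hp
  have hstep : ∀ i, moreau X F t (x (k + 1) i) ≤ moreau X F t (v i)
      + (α k / t * (f i p - f i z) + α k / t * (ρ / 2 * ‖p - z‖ ^ 2 + 6 * L * D)
        + α k ^ 2 * L ^ 2 / (2 * t)) := fun i => by
    obtain ⟨g, hg, hpr⟩ := R.step k i
    have h₁ := H.moreau_step_le h ha (hvX i) hg hpr
    have h₂ := mul_le_mul_of_nonneg_left (H.decrease_le h i (hvX i) hzX (hvD i))
      (div_pos ha ht).le
    linarith
  have hsum := Finset.sum_le_sum fun i (_ : i ∈ Finset.univ) => hstep i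
  simp only [Finset.sum_add_distrib, ← Finset.mul_sum, Finset.sum_sub_distrib,
    sum_objective f hN, Finset.sum_const, Finset.card_univ, Fintype.card_fin, nsmul_eq_mul] at hsum
  have hdesc := mul_le_mul_of_nonneg_left (h.prox_descent hzX) (div_pos ha ht).le
  have hgrad : ‖gradient (moreau X F t) z‖ ^ 2 = 1 / t ^ 2 * ‖p - z‖ ^ 2 := by
    rw [h.norm_gradient_moreau, mul_pow, div_pow, one_pow]
  have hyoung : α k / t * (6 * L * D) + α k ^ 2 * L ^ 2 / (2 * t)
      ≤ 4 / t * D ^ 2 + 12 / t * (L * α k) ^ 2 := by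
    rw [← sub_nonneg]
    have e : 4 / t * D ^ 2 + 12 / t * (L * α k) ^ 2
        - (α k / t * (6 * L * D) + α k ^ 2 * L ^ 2 / (2 * t))
        = 1 / t * ((2 * D - 3 / 2 * (L * α k)) ^ 2 + (12 - 9 / 4 - 1 / 2) * (L * α k) ^ 2) := by
      field_simp; ring
    rw [e]; positivity
  have hk : N * phibar X f t x k = ∑ i, moreau X F t (x k i) := by
    rw [phibar, ← hF]; field_simp
  have hk' : N * phibar X f t x (k + 1) = ∑ i, moreau X F t (x (k + 1) i) := by
    rw [phibar, ← hF]; field_simp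
  refine le_of_mul_le_mul_left ?_ hN'
  rw [mul_add, mul_add, hk, hk', hgrad]
  have e₁ : α k / t * (-(1 / (2 * t)) * ‖p - z‖ ^ 2)
      = -(α k / 2 * (1 / t ^ 2 * ‖p - z‖ ^ 2)) := by field_simp
  rw [e₁] at hdesc
  have hdN := mul_le_mul_of_nonneg_left hdesc hN'.le
  have hyN := mul_le_mul_of_nonneg_left hyoung hN'.le
  simp only [← hF, ← hp] at hsum hdN
  linear_combination hsum + hdN + hyN + hs₁ + hs₂'

end IsRun

end Run

/-! ### Sequences and stepsizes -/

section Sequences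

/-- A sequence that is bounded below and increases by summable amounts at most converges. -/
theorem exists_tendsto_of_le_add_summable {a ε : ℕ → ℝ} {m : ℝ} (hm : ∀ k, m ≤ a k)
    (hε : ∀ k, 0 ≤ ε k) (hs : Summable ε) (h : ∀ k, a (k + 1) ≤ a k + ε k) :
    ∃ l, Tendsto a atTop (𝓝 l) := by
  have hanti : Antitone fun k => a k - ∑ j ∈ Finset.range k, ε j :=
    antitone_nat_of_succ_le fun k => by
      rw [Finset.sum_range_succ]; linarith [h k]
  have hbdd : BddBelow (Set.range fun k => a k - ∑ j ∈ Finset.range k, ε j) := by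
    refine ⟨m - ∑' j, ε j, ?_⟩
    rintro _ ⟨k, rfl⟩
    exact sub_le_sub (hm k) (hs.sum_le_tsum _ fun j _ => hε j)
  have := (tendsto_atTop_ciInf hanti hbdd).add hs.hasSum.tendsto_sum_nat
  exact ⟨_, by simpa using this⟩

/-- The error in one step of the method: disagreement and stepsize, both squared. -/
noncomputable def stepError (t lam u₀ b L : ℝ) (α : ℕ → ℝ) (k : ℕ) : ℝ :=
  12 / t * ((geomConv lam u₀ (fun k => b * L * α k) k + 2 * (L * α k)) ^ 2 + (L * α (k + 1)) ^ 2)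

theorem sum_stepError_le {t lam u₀ b L : ℝ} {α : ℕ → ℝ} (ht : 0 < t) (h₀ : 0 < lam) (h₁ : lam < 1)
    (T : ℕ) : ∑ k ∈ Finset.range T, stepError t lam u₀ b L α k
      ≤ 12 / t * (2 * (u₀ ^ 2 / (1 - lam))
        + (2 * b ^ 2 + 9) * (L ^ 2 / (1 - lam) ^ 2 * ∑ k ∈ Finset.range (T + 1), α k ^ 2)) := by
  have hu := sum_geomConv_sq_le (u₀ := u₀) (β := fun k => b * L * α k) h₀ h₁ T
  set u := geomConv lam u₀ fun k => b * L * α k with hu_def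
  set S := ∑ k ∈ Finset.range (T + 1), α k ^ 2 with hS
  have hl : 0 < 1 - lam := sub_pos.2 h₁
  have hS₁ : ∑ k ∈ Finset.range T, α k ^ 2 ≤ S := by
    rw [hS, Finset.sum_range_succ]; linarith [sq_nonneg (α T)]
  have hS₂ : ∑ k ∈ Finset.range T, α (k + 1) ^ 2 ≤ S := by
    rw [hS, Finset.sum_range_succ']; linarith [sq_nonneg (α 0)]
  have hterm : ∀ k, (u k + 2 * (L * α k)) ^ 2 + (L * α (k + 1)) ^ 2
      ≤ 2 * u k ^ 2 + (8 * L ^ 2 * α k ^ 2 + L ^ 2 * α (k + 1) ^ 2) := fun k => by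
    linarith [sq_nonneg (u k - 2 * (L * α k))]
  simp only [stepError]
  rw [← Finset.mul_sum]
  refine mul_le_mul_of_nonneg_left ?_ (by positivity)
  refine (Finset.sum_le_sum fun k _ => hterm k).trans ?_
  rw [Finset.sum_add_distrib, Finset.sum_add_distrib, ← Finset.mul_sum, ← Finset.mul_sum,
    ← Finset.mul_sum]
  have hb : ∑ k ∈ Finset.range T, (b * L * α k) ^ 2
      = b ^ 2 * L ^ 2 * ∑ k ∈ Finset.range T, α k ^ 2 := by
    rw [Finset.mul_sum]; exact Finset.sum_congr rfl fun k _ => by ring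
  rw [hb] at hu
  have hS₀ : 0 ≤ S := Finset.sum_nonneg fun k _ => sq_nonneg _
  have hQ : L ^ 2 ≤ L ^ 2 / (1 - lam) ^ 2 :=
    le_div_self (sq_nonneg L) (by positivity) (pow_le_one₀ hl.le (by linarith))
  have e : 1 / (1 - lam) ^ 2 * (b ^ 2 * L ^ 2 * ∑ k ∈ Finset.range T, α k ^ 2)
      = b ^ 2 * (L ^ 2 / (1 - lam) ^ 2) * ∑ k ∈ Finset.range T, α k ^ 2 := by ring
  rw [e] at hu
  have h₃ := mul_le_mul_of_nonneg_left hS₁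
    (by positivity : 0 ≤ b ^ 2 * (L ^ 2 / (1 - lam) ^ 2))
  have h₄ := mul_le_mul_of_nonneg_left hS₁ (by positivity : 0 ≤ 8 * L ^ 2)
  have h₅ := mul_le_mul_of_nonneg_left hS₂ (sq_nonneg L)
  have h₆ := mul_le_mul_of_nonneg_right hQ hS₀
  linarith

/-- Stepsizes of order at most `1 / √k` have logarithmically growing sums of squares. -/
theorem exists_sum_sq_le_log {α : ℕ → ℝ} {c₂ : ℝ} (hα : ∀ k, 0 < α k)
    (h : ∀ᶠ k : ℕ in atTop, α k ≤ c₂ / √(k : ℝ)) :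
    ∃ K, ∀ T : ℕ, ∑ k ∈ Finset.range (T + 1), α k ^ 2 ≤ K + c₂ ^ 2 * Real.log T := by
  obtain ⟨k₀, hk₀⟩ := eventually_atTop.1 h
  refine ⟨∑ k ∈ Finset.range k₀, α k ^ 2 + c₂ ^ 2, fun T => ?_⟩
  have hterm : ∀ k, α k ^ 2 ≤ (if k < k₀ then α k ^ 2 else 0) + c₂ ^ 2 * (k : ℝ)⁻¹ := fun k => by
    split_ifs with hk
    · have : 0 ≤ c₂ ^ 2 * (k : ℝ)⁻¹ := by positivity
      linarith
    · have := pow_le_pow_left₀ (hα k).le (hk₀ k (not_lt.1 hk)) 2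
      rw [div_pow, Real.sq_sqrt (Nat.cast_nonneg k), div_eq_mul_inv] at this
      linarith
  refine (Finset.sum_le_sum fun k _ => hterm k).trans ?_
  rw [Finset.sum_add_distrib, ← Finset.sum_filter, ← Finset.mul_sum, Finset.sum_range_succ' _ T]
  have h₁ : ∑ k ∈ (Finset.range (T + 1)).filter (· < k₀), α k ^ 2
      ≤ ∑ k ∈ Finset.range k₀, α k ^ 2 :=
    Finset.sum_le_sum_of_subset_of_nonneg
      (fun k hk => Finset.mem_range.2 (Finset.mem_filter.1 hk).2) fun k _ _ => sq_nonneg _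
  have h₂ : ∑ k ∈ Finset.range T, ((k + 1 : ℕ) : ℝ)⁻¹ ≤ 1 + Real.log T := by
    simpa [harmonic] using harmonic_le_one_add_log T
  have h₃ := mul_le_mul_of_nonneg_left h₂ (sq_nonneg c₂)
  -- the term at `k = 0` vanishes, as `0⁻¹ = 0`
  simp only [Nat.cast_zero, inv_zero, add_zero]
  linarith

theorem sqrt_le_sum_of_le {α : ℕ → ℝ} {c₁ : ℝ} (hc₁ : 0 < c₁) (hα : ∀ k, 0 < α k)
    (h : ∀ᶠ k : ℕ in atTop, c₁ / √(k : ℝ) ≤ α k) :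
    ∀ᶠ T : ℕ in atTop, c₁ / 2 * √(T : ℝ) ≤ ∑ l ∈ Finset.Icc 1 T, α l := by
  obtain ⟨k₀, hk₀⟩ := eventually_atTop.1 h
  filter_upwards [eventually_ge_atTop (2 * (k₀ + 1))] with T hT
  have hT₀ : (0 : ℝ) < T := Nat.cast_pos.2 (by omega)
  have h₁ : ∑ l ∈ Finset.Icc (k₀ + 1) T, α l ≤ ∑ l ∈ Finset.Icc 1 T, α l :=
    Finset.sum_le_sum_of_subset_of_nonneg (Finset.Icc_subset_Icc_left (by omega))
      fun k _ _ => (hα k).le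
  refine le_trans ?_ h₁
  have h₂ := Finset.card_nsmul_le_sum (Finset.Icc (k₀ + 1) T) α (c₁ / √(T : ℝ)) fun k hk => by
    rw [Finset.mem_Icc] at hk
    have hk' : (0 : ℝ) < k := Nat.cast_pos.2 (by omega)
    exact (div_le_div_of_nonneg_left hc₁.le (Real.sqrt_pos.2 hk')
      (Real.sqrt_le_sqrt (Nat.cast_le.2 hk.2))).trans (hk₀ k (by omega))
  refine le_trans ?_ h₂
  rw [nsmul_eq_mul, Nat.card_Icc]
  have h₃ : (T : ℝ) / 2 ≤ ((T + 1 - (k₀ + 1) : ℕ) : ℝ) := by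
    rw [div_le_iff₀ two_pos]
    exact_mod_cast (by omega : T ≤ (T + 1 - (k₀ + 1)) * 2)
  have h₄ : c₁ / 2 * √(T : ℝ) = T / 2 * (c₁ / √(T : ℝ)) := by
    have : √(T : ℝ) ≠ 0 := (Real.sqrt_pos.2 hT₀).ne'
    field_simp
    exact Real.sq_sqrt hT₀.le
  rw [h₄]
  exact mul_le_mul_of_nonneg_right h₃ (by positivity)

/-- If a weighted sum of `G` is at most `R` times the sum of the weights, then some term of `G` is at
most `R`. -/
theorem exists_le_of_sum_mul_le {α G : ℕ → ℝ} {T : ℕ} {R : ℝ} (hT : 1 ≤ T) (hα : ∀ k, 0 < α k)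
    (h : ∑ k ∈ Finset.Icc 1 T, α k * G k ≤ R * ∑ k ∈ Finset.Icc 1 T, α k) :
    ∃ k ∈ Finset.Icc 1 T, G k ≤ R := by
  obtain ⟨k, hk, hle⟩ := Finset.exists_le_of_sum_le
    (Finset.nonempty_Icc.2 hT) (f := fun k => α k * G k) (g := fun k => α k * R)
    (by rwa [← Finset.sum_mul, mul_comm])
  exact ⟨k, hk, le_of_mul_le_mul_left hle (hα k)⟩

end Sequences

/-! ### Convergence and rates -/

section Convergence

variable {n N : ℕ} {X : Set (E n)} {f : Fin N → E n → ℝ} {ρ t : ℝ} {L : NNReal}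

theorem IsRegular.exists_le_moreau {F : E n → ℝ} (h : IsRegular X F ρ t L) :
    ∃ m, ∀ z, m ≤ moreau X F t z := by
  obtain ⟨m, hm⟩ := h.bddBelow
  refine ⟨m, fun z => ?_⟩
  rw [h.moreau_eq]
  have h₁ := hm (Set.mem_image_of_mem F (h.prox_mem z))
  have := h.t_pos
  have : 0 ≤ ‖prox X F t z - z‖ ^ 2 / (2 * t) := by positivity
  linarith

/-- For a function that is constant on `X`, the envelope is constant on `X`. -/
theorem IsRegular.moreau_eq_of_lipschitz_zero {F : E n → ℝ} (h : IsRegular X F ρ t 0) {y z : E n}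
    (hy : y ∈ X) (hz : z ∈ X) : moreau X F t y = moreau X F t z := by
  have key : ∀ w ∈ X, moreau X F t w = F w := fun w hw => by
    have h₁ := h.norm_prox_sub_self_le hw
    rw [NNReal.coe_zero, mul_zero, norm_le_zero_iff, sub_eq_zero] at h₁
    rw [h.moreau_eq, h₁]; simp
  have h₁ := h.abs_sub_le hy hz
  rw [NNReal.coe_zero, zero_mul, abs_nonpos_iff, sub_eq_zero] at h₁
  rw [key y hy, key z hz, h₁]

theorem le_phibar (hN : 0 < N) {m : ℝ} (hm : ∀ z, m ≤ moreau X (objective f) t z)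
    (x : ℕ → Fin N → E n) (k : ℕ) : m ≤ phibar X f t x k := by
  have hN' : (0 : ℝ) < N := Nat.cast_pos.2 hN
  rw [phibar, one_div, le_inv_mul_iff₀ hN']
  simpa using Finset.card_nsmul_le_sum Finset.univ (fun i => moreau X (objective f) t (x k i)) m
    fun i _ => hm _

namespace IsRun

variable {A : ℕ → Matrix (Fin N) (Fin N) ℝ} {η : ℝ} {B : ℕ} {α : ℕ → ℝ} {x : ℕ → Fin N → E n}
  (R : IsRun X f A α x)

include R

/-- The recursion that governs the method, with an explicit bound on the disagreement. The index is
shifted because the consensus bound concerns the iterates after the first step. -/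
theorem exists_recursion (hN : 0 < N) (H : IsProblem X f ρ L)
    (h : IsRegular X (objective f) ρ t L) (hA : IsNetwork A η B) (hα : ∀ k, 0 < α k) {c lam : ℝ}
    (hmix : IsMixing A c lam) : ∃ u₀, ∀ k,
      phibar X f t x (k + 2)
          + α (k + 1) / 2 * ‖gradient (moreau X (objective f) t) (xbar x (k + 1))‖ ^ 2
        ≤ phibar X f t x (k + 1) + stepError t lam u₀ (c * N) L α k ∧
      |phibar X f t x (k + 1) - moreau X (objective f) t (xbar x (k + 1))|
        ≤ stepError t lam u₀ (c * N) L α k := by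
  set r := ∑ i, ‖x 0 i‖
  have hr : ∀ i, ‖x 0 i‖ ≤ r := fun i =>
    Finset.single_le_sum (f := fun i => ‖x 0 i‖) (fun i _ => norm_nonneg _) (Finset.mem_univ i)
  have hN' : (0 : ℝ) < N := Nat.cast_pos.2 hN
  have ht := h.t_pos
  refine ⟨c * N * r, fun k => ?_⟩
  have hD := R.norm_sub_xbar_le hN H hA hα hmix hr k
  refine ⟨R.phibar_succ_le hN H h hA hα hD, ?_⟩
  have h₁ := h.abs_sum_moreau_sub_le (sum_sub_avg (x (k + 1)) hN) hD
  change |∑ i, moreau X (objective f) t (x (k + 1) i)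
    - N * moreau X (objective f) t (xbar x (k + 1))| ≤ _ at h₁
  have e : ∑ i, moreau X (objective f) t (x (k + 1) i)
      - N * moreau X (objective f) t (xbar x (k + 1))
      = N * (phibar X f t x (k + 1) - moreau X (objective f) t (xbar x (k + 1))) := by
    rw [phibar]; field_simp
  rw [e, abs_mul, abs_of_pos hN'] at h₁
  refine (le_of_mul_le_mul_left h₁ hN').trans ?_
  rw [stepError, mul_add]
  refine (mul_le_mul_of_nonneg_right ?_ (sq_nonneg _)).trans
    (le_add_of_nonneg_right (by positivity))
  exact div_le_div_of_nonneg_right (by norm_num) ht.le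

theorem exists_tendsto_phibar (hN : 0 < N) (H : IsProblem X f ρ L)
    (h : IsRegular X (objective f) ρ t L) (hA : IsNetwork A η B) (hα : ∀ k, 0 < α k)
    (hsq : Summable fun k => α k ^ 2) : ∃ φlim : ℝ, Tendsto (phibar X f t x) atTop (𝓝 φlim) ∧
      Tendsto (fun k => moreau X (objective f) t (xbar x k)) atTop (𝓝 φlim) := by
  obtain ⟨c, lam, -, hl₀, hl₁, hmix⟩ := hA.exists_isMixing hN
  obtain ⟨u₀, hrec⟩ := R.exists_recursion hN H h hA hα hmix
  have ht := h.t_pos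
  set ε := stepError t lam u₀ (c * N) L α with hε
  have hε₀ : ∀ k, 0 ≤ ε k := fun k => (abs_nonneg _).trans (hrec k).2
  have hεs : Summable ε := by
    refine summable_of_sum_range_le (c := 12 / t * (2 * (u₀ ^ 2 / (1 - lam))
      + (2 * (c * N) ^ 2 + 9) * ((L : ℝ) ^ 2 / (1 - lam) ^ 2 * ∑' k, α k ^ 2))) hε₀
      fun T => (sum_stepError_le ht hl₀ hl₁ T).trans ?_
    have := hsq.sum_le_tsum (Finset.range (T + 1)) fun k _ => sq_nonneg (α k)
    gcongr
  obtain ⟨m, hm⟩ := h.exists_le_moreau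
  obtain ⟨l, hl⟩ := exists_tendsto_of_le_add_summable
    (a := fun k => phibar X f t x (k + 1)) (fun k => le_phibar hN hm x _) hε₀ hεs fun k => by
      have := (hrec k).1
      have : 0 ≤ α (k + 1) / 2 * ‖gradient (moreau X (objective f) t) (xbar x (k + 1))‖ ^ 2 :=
        mul_nonneg (by linarith [hα (k + 1)]) (sq_nonneg _)
      linarith
  refine ⟨l, (tendsto_add_atTop_iff_nat 1).1 hl, (tendsto_add_atTop_iff_nat 1).1 ?_⟩
  have h₀ := squeeze_zero_norm (a := ε)
    (f := fun k => phibar X f t x (k + 1) - moreau X (objective f) t (xbar x (k + 1)))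
    (fun k => (hrec k).2) hεs.tendsto_atTop_zero
  simpa using hl.sub h₀

/-- The weighted sum of the squared gradients grows at most logarithmically. -/
theorem exists_sum_gradient_le (hN : 0 < N) (H : IsProblem X f ρ L)
    (h : IsRegular X (objective f) ρ t L) (hA : IsNetwork A η B) (hα : ∀ k, 0 < α k)
    {c lam c₂ : ℝ} (hl₀ : 0 < lam) (hl₁ : lam < 1) (hmix : IsMixing A c lam)
    (hα₂ : ∀ᶠ k : ℕ in atTop, α k ≤ c₂ / √(k : ℝ)) : ∃ K : ℝ, ∀ T : ℕ,
      ∑ k ∈ Finset.Icc 1 T, α k * ‖gradient (moreau X (objective f) t) (xbar x k)‖ ^ 2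
        ≤ K + 24 / t * (2 * (c * N) ^ 2 + 9) * c₂ ^ 2
          * ((L : ℝ) ^ 2 / (1 - lam) ^ 2 * Real.log T) := by
  obtain ⟨u₀, hrec⟩ := R.exists_recursion hN H h hA hα hmix
  obtain ⟨K, hK⟩ := exists_sum_sq_le_log hα hα₂
  obtain ⟨m, hm⟩ := h.exists_le_moreau
  have ht := h.t_pos
  have hl : 0 < 1 - lam := sub_pos.2 hl₁
  set Q := (L : ℝ) ^ 2 / (1 - lam) ^ 2 with hQ
  have hQ₀ : 0 ≤ Q := by positivity
  set G : ℕ → ℝ := fun k => ‖gradient (moreau X (objective f) t) (xbar x k)‖ ^ 2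
  refine ⟨2 * (phibar X f t x 1 - m) + 24 / t * (2 * (u₀ ^ 2 / (1 - lam)))
    + 24 / t * (2 * (c * N) ^ 2 + 9) * (Q * K), fun T => ?_⟩
  have htel : phibar X f t x (T + 1) + ∑ k ∈ Finset.Icc 1 T, α k / 2 * G k
      ≤ phibar X f t x 1 + ∑ k ∈ Finset.range T, stepError t lam u₀ (c * N) L α k := by
    induction T with
    | zero => simp
    | succ T ih =>
      rw [Finset.sum_Icc_succ_top (by omega), Finset.sum_range_succ]
      linarith [(hrec T).1]
  have h₁ := sum_stepError_le (u₀ := u₀) (b := c * N) (L := L) (α := α) ht hl₀ hl₁ T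
  have h₂ := le_phibar hN hm x (T + 1)
  have h₃ : ∑ k ∈ Finset.Icc 1 T, α k * G k = 2 * ∑ k ∈ Finset.Icc 1 T, α k / 2 * G k := by
    rw [Finset.mul_sum]; exact Finset.sum_congr rfl fun k _ => by ring
  have h₄ := mul_le_mul_of_nonneg_left (hK T)
    (by positivity : 0 ≤ 24 / t * (2 * (c * N) ^ 2 + 9) * Q)
  have e : (24 / t : ℝ) = 2 * (12 / t) := by ring
  rw [e] at h₄ ⊢
  change ∑ k ∈ Finset.Icc 1 T, α k * G k ≤ _
  rw [h₃]
  linarith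

/-- The two rates, in the form in which the constant depends on `N`, `t`, `c`, `c₁` and `c₂` only. -/
theorem eventually_exists_gradient_le (hN : 0 < N) (H : IsProblem X f ρ L)
    (h : IsRegular X (objective f) ρ t L) (hA : IsNetwork A η B) (hα : ∀ k, 0 < α k)
    {c lam c₁ c₂ C : ℝ} (hl₀ : 0 < lam) (hl₁ : lam < 1) (hmix : IsMixing A c lam)
    (hc₁ : 0 < c₁) (hα₂ : ∀ᶠ k : ℕ in atTop, α k ≤ c₂ / √(k : ℝ))
    (hC : C = (1 + 2 / c₁) * (24 / t * (2 * (c * N) ^ 2 + 9) * c₂ ^ 2) + 1) {φlim : ℝ}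
    (hφ : (φlim : EReal) ≤ liminf (fun k => ((phibar X f t x k : ℝ) : EReal)) atTop) :
    (∀ᶠ T : ℕ in atTop, ∃ k ∈ Finset.Icc 1 T,
      ‖gradient (moreau X (objective f) t) (xbar x k)‖ ^ 2 ≤
        C * ((phibar X f t x 0 - φlim) / (∑ l ∈ Finset.Icc 1 T, α l) +
          (L : ℝ) ^ 2 / (1 - lam) ^ 2 * (Real.log T / ∑ l ∈ Finset.Icc 1 T, α l))) ∧
    ((∀ᶠ k : ℕ in atTop, c₁ / √(k : ℝ) ≤ α k) →
      ∀ᶠ T : ℕ in atTop, ∃ k ∈ Finset.Icc 1 T,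
        ‖gradient (moreau X (objective f) t) (xbar x k)‖ ^ 2 ≤
          C * ((phibar X f t x 0 - φlim) / √(T : ℝ) +
            (L : ℝ) ^ 2 / (1 - lam) ^ 2 * (Real.log T / √(T : ℝ)))) := by
  have ht := h.t_pos
  have hC₀ : 0 < C := by rw [hC]; positivity
  have hl : 0 < 1 - lam := sub_pos.2 hl₁
  set D := phibar X f t x 0 - φlim with hD
  set Q := (L : ℝ) ^ 2 / (1 - lam) ^ 2 with hQ
  set G : ℕ → ℝ := fun k => ‖gradient (moreau X (objective f) t) (xbar x k)‖ ^ 2 with hG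
  have hS : ∀ T : ℕ, 1 ≤ T → 0 < ∑ l ∈ Finset.Icc 1 T, α l := fun T hT =>
    Finset.sum_pos (fun k _ => hα k) (Finset.nonempty_Icc.2 hT)
  -- the gradient sum is eventually dominated by the logarithm, constants included
  have key : ∀ᶠ T : ℕ in atTop, ∃ M, 0 ≤ M ∧ ∑ k ∈ Finset.Icc 1 T, α k * G k ≤ M ∧
      (1 + 2 / c₁) * M ≤ C * (D + Q * Real.log T) := by
    rcases eq_or_ne L 0 with rfl | hL
    · -- `f` is constant on `X`, so that all gradients vanish and `phibar` is constant
      refine Eventually.of_forall fun T => ⟨0, le_rfl, ?_, ?_⟩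
      · refine (Finset.sum_eq_zero fun k _ => ?_).le
        have h₁ := h.norm_prox_sub_self_le (avg_mem hN H.convex (R.mem k))
        rw [NNReal.coe_zero, mul_zero] at h₁
        have h₂ := le_antisymm h₁ (norm_nonneg _)
        have h₃ : G k = 0 := by
          simp only [hG]
          rw [h.norm_gradient_moreau]
          change (1 / t * ‖prox X (objective f) t (avg (x k)) - avg (x k)‖) ^ 2 = 0
          rw [h₂]; simp
        rw [h₃, mul_zero]
      · have hconst : ∀ k, phibar X f t x k = phibar X f t x 0 := fun k => by
          simp only [phibar]
          congr 1
          exact Finset.sum_congr rfl fun i _ =>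
            h.moreau_eq_of_lipschitz_zero (R.mem k i) (R.mem 0 i)
        simp only [hconst, liminf_const, EReal.coe_le_coe_iff] at hφ
        have hQ0 : Q = 0 := by simp [hQ]
        rw [hQ0, mul_zero, zero_mul, add_zero]
        exact mul_nonneg hC₀.le (sub_nonneg.2 hφ)
    · obtain ⟨K, hK⟩ := R.exists_sum_gradient_le hN H h hA hα hl₀ hl₁ hmix hα₂
      have hQ₀ : 0 < Q := by
        have : (0 : ℝ) < L := NNReal.coe_pos.2 (pos_iff_ne_zero.2 hL)
        positivity
      set C₀ := 24 / t * (2 * (c * N) ^ 2 + 9) * c₂ ^ 2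
      have hlog : Tendsto (fun T : ℕ => Q * Real.log T) atTop atTop :=
        (Real.tendsto_log_atTop.comp tendsto_natCast_atTop_atTop).const_mul_atTop hQ₀
      filter_upwards [hlog.eventually_ge_atTop ((1 + 2 / c₁) * |K| - C * D),
        eventually_ge_atTop 1] with T hT hT₁
      have hlogT : 0 ≤ Real.log T := Real.log_nonneg (by exact_mod_cast hT₁)
      refine ⟨|K| + C₀ * (Q * Real.log T), by positivity,
        (hK T).trans (by linarith [le_abs_self K]), ?_⟩
      rw [hC] at hT ⊢
      linarith
  constructor
  · filter_upwards [key, eventually_ge_atTop 1] with T ⟨M, hM₀, hM, hMC⟩ hT₁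
    refine exists_le_of_sum_mul_le hT₁ hα (hM.trans ?_)
    have hST := hS T hT₁
    have e : C * (D / (∑ l ∈ Finset.Icc 1 T, α l) + Q * (Real.log T / ∑ l ∈ Finset.Icc 1 T, α l))
        * ∑ l ∈ Finset.Icc 1 T, α l = C * (D + Q * Real.log T) := by
      field_simp
    rw [e]
    have : 0 ≤ 2 / c₁ * M := by positivity
    linarith
  · intro hα₁
    filter_upwards [key, eventually_ge_atTop 1, sqrt_le_sum_of_le hc₁ hα hα₁]
      with T ⟨M, hM₀, hM, hMC⟩ hT₁ hsq
    refine exists_le_of_sum_mul_le hT₁ hα (hM.trans ?_)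
    have hT₀ : 0 < √(T : ℝ) := Real.sqrt_pos.2 (by exact_mod_cast hT₁)
    have e : C * (D / √(T : ℝ) + Q * (Real.log T / √(T : ℝ)))
        = C * (D + Q * Real.log T) / √(T : ℝ) := by
      field_simp
    rw [e]
    calc M = 2 / c₁ * M / √(T : ℝ) * (c₁ / 2 * √(T : ℝ)) := by field_simp
      _ ≤ C * (D + Q * Real.log T) / √(T : ℝ) * ∑ l ∈ Finset.Icc 1 T, α l := by
        have h₁ : 2 / c₁ * M ≤ C * (D + Q * Real.log T) := by linarith
        have h₂ : 0 ≤ 2 / c₁ * M := by positivity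
        exact mul_le_mul (div_le_div_of_nonneg_right h₁ hT₀.le) hsq (by positivity)
          (div_nonneg (h₂.trans h₁) hT₀.le)

end IsRun

end Convergence

end DPSM

theorem mainTheorem1 (N : ℕ) (hN : 0 < N) (ρ t : ℝ) (hρ : 0 < ρ) (ht : 0 < t)
    (htρ : t < 1 / (2 * ρ)) :
    -- the Moreau envelope is differentiable, so that the gradients below are genuine
    (∀ (n : ℕ) (X : Set (DPSM.E n)) (f : Fin N → DPSM.E n → ℝ) (L : NNReal),
      DPSM.IsProblem X f ρ L →
      Differentiable ℝ (DPSM.moreau X (DPSM.objective f) t)) ∧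
    -- (1) convergence of the envelope values
    (∀ (n : ℕ) (X : Set (DPSM.E n)) (f : Fin N → DPSM.E n → ℝ) (L : NNReal)
      (A : ℕ → Matrix (Fin N) (Fin N) ℝ) (η : ℝ) (B : ℕ) (α : ℕ → ℝ) (x : ℕ → Fin N → DPSM.E n),
      DPSM.IsProblem X f ρ L → DPSM.IsNetwork A η B → DPSM.IsRun X f A α x →
      (∀ k, 0 < α k) → Tendsto (fun k => α (k + 1) / α k) atTop (𝓝 1) →
      Tendsto (fun T => ∑ k ∈ Finset.range T, α k) atTop atTop →
      Summable (fun k => α k ^ 2) →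
      ∃ φlim : ℝ, Tendsto (DPSM.phibar X f t x) atTop (𝓝 φlim) ∧
        Tendsto (fun k => DPSM.moreau X (DPSM.objective f) t (DPSM.xbar x k)) atTop (𝓝 φlim)) ∧
    -- every such network has a geometric mixing rate
    (∀ (A : ℕ → Matrix (Fin N) (Fin N) ℝ) (η : ℝ) (B : ℕ), DPSM.IsNetwork A η B →
      ∃ c lam : ℝ, 0 < c ∧ 0 < lam ∧ lam < 1 ∧ DPSM.IsMixing A c lam) ∧
    -- (2) rate for stepsizes `O(1/√k)`, with a constant `C` that depends on
    -- `N, ρ, t, c, c₁, c₂` only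
    (∀ c c₁ c₂ : ℝ, 0 < c → 0 < c₁ → 0 < c₂ → ∃ C : ℝ, 0 < C ∧
      ∀ (n : ℕ) (X : Set (DPSM.E n)) (f : Fin N → DPSM.E n → ℝ) (L : NNReal)
        (A : ℕ → Matrix (Fin N) (Fin N) ℝ) (η : ℝ) (B : ℕ) (lam : ℝ) (α : ℕ → ℝ)
        (x : ℕ → Fin N → DPSM.E n),
        DPSM.IsProblem X f ρ L → DPSM.IsNetwork A η B → DPSM.IsRun X f A α x →
        0 < lam → lam < 1 → DPSM.IsMixing A c lam →
        (∀ k, 0 < α k) → Tendsto (fun k => α (k + 1) / α k) atTop (𝓝 1) →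
        (∀ᶠ k : ℕ in atTop, α k ≤ c₂ / √(k : ℝ)) →
        ∀ φlim : ℝ,
          (φlim : EReal) ≤ liminf (fun k => ((DPSM.phibar X f t x k : ℝ) : EReal)) atTop →
          (∀ᶠ T : ℕ in atTop, ∃ k ∈ Finset.Icc 1 T,
            ‖gradient (DPSM.moreau X (DPSM.objective f) t) (DPSM.xbar x k)‖ ^ 2 ≤
              C * ((DPSM.phibar X f t x 0 - φlim) / (∑ l ∈ Finset.Icc 1 T, α l) +
                (L : ℝ) ^ 2 / (1 - lam) ^ 2 *
                  (Real.log T / ∑ l ∈ Finset.Icc 1 T, α l))) ∧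
          ((∀ᶠ k : ℕ in atTop, c₁ / √(k : ℝ) ≤ α k) →
            ∀ᶠ T : ℕ in atTop, ∃ k ∈ Finset.Icc 1 T,
              ‖gradient (DPSM.moreau X (DPSM.objective f) t) (DPSM.xbar x k)‖ ^ 2 ≤
                C * ((DPSM.phibar X f t x 0 - φlim) / √(T : ℝ) +
                  (L : ℝ) ^ 2 / (1 - lam) ^ 2 * (Real.log T / √(T : ℝ))))) := by
  refine ⟨fun n X f L H => (H.isRegular hN hρ ht htρ).differentiable_moreau, ?_, ?_, ?_⟩
  · intro n X f L A η B α x H hA R hα _ _ hsq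
    exact R.exists_tendsto_phibar hN H (H.isRegular hN hρ ht htρ) hA hα hsq
  · intro A η B hA
    exact hA.exists_isMixing hN
  · intro c c₁ c₂ _ hc₁ _
    refine ⟨(1 + 2 / c₁) * (24 / t * (2 * (c * N) ^ 2 + 9) * c₂ ^ 2) + 1, by positivity, ?_⟩
    intro n X f L A η B lam α x H hA R hl₀ hl₁ hmix hα _ hα₂ φlim hφ
    exact R.eventually_exists_gradient_le hN H (H.isRegular hN hρ ht htρ) hA hα hl₀ hl₁ hmix hc₁
      hα₂ rfl hφ
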